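/- **Setting.** Let $H$ be a finite-dimensional Hopf algebra over an arbitrary field $\Bbbk$, with comultiplication $\Delta$, counit $\varepsilon$ and antipode $S$. Put $\Delta^{(0)}=\varepsilon$ and $\Delta^{(m+1)}=(\mathrm{id}\otimes\Delta^{(m)})\circ\Delta$, and write $\Delta^{(m)}(x)=x_{(1)}\otimes\cdots\otimes x_{(m)}$. The $m$-th Sweedler power is $P^{(m)}(x)=x_{(1)}x_{(2)}\cdots x_{(m)}$. For an integer $n>1$ and an integer $k$ coprime to $n$, let $\overline{a}\in\{1,\dots,n\}$ denote the least positive residue of $a$ modulo $n$. Then $i\mapsto\overline{ik}$ is a permutation of $\{1,\dots,n-1\}$. With $\Delta^{(n-1)}(x)=x_{(1)}\otimes\cdots\otimes x_{(n-1)}$, define the shuffled Sweedler power and the associated scalar by $$\tilde P^{(n,k)}(x)=x_{(\overline{k})}\,x_{(\overline{2k})}\cdots x_{(\overline{(n-1)k})},\qquad \tilde\nu_{n,k}(H)=\operatorname{Tr}\bigl(S\circ\tilde P^{(n,k)}\bigr)\in\Bbbk .$$ A 2-cocycle of $H$ is an invertible element $F\in H\otimes H$ such that $(\varepsilon\otimes\mathrm{id})(F)=1=(\mathrm{id}\otimes\varepsilon)(F)$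 and $$1\otimes 1\otimes 1=(1\otimes F)\,(\mathrm{id}\otimes\Delta)(F)\,(\Delta\otimes\mathrm{id})(F^{-1})\,(F^{-1}\otimes 1).$$ The Drinfeld twist $H_F$ is the Hopf algebra which equals $H$ as an algebra, with the same counit, comultiplication $\Delta_F(h)=F\Delta(h)F^{-1}$ and antipode $S_F(h)=u\,S(h)\,u^{-1}$. Here $u=\sum_i f_i S(f_i')$ for $F=\sum_i f_i\otimes f_i'$, and $u^{-1}=\sum_j S(d_j)d_j'$ for $F^{-1}=\sum_j d_j\otimes d_j'$. **Theorem.** Let $F\in H\otimes H$ be a 2-cocycle of $H$, and let $n,k$ be coprime integers with $n>1$. Then $$\tilde\nu_{n,k}(H_F)=\tilde\nu_{n,k}(H).$$ Consequently $\tilde\nu_{n,k}(H')=\tilde\nu_{n,k}(H)$ for every Hopf algebra $H'$ over $\Bbbk$ that is isomorphic to $H_F$ as a bialgebra. Moreover $\tilde\nu_{n,1}(H)=\operatorname{Tr}(S\circ P^{(n-1)})$, which is the $n$-th indicator $\nu_n(H)$ of Kashina, Montgomery and Ng; so $\tilde\nu_{n,k}$ generalizes $\nu_n$. -/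

import Mathlib

open scoped TensorProduct

noncomputable section

/-! ### Iterated comultiplication, iterated product, permutations of tensors -/

section Sweedler

variable (k : Type*) [Field k] (H : Type*) [Ring H] [HopfAlgebra k H]

/-- The map `H ⊗ H^{⊗ n} → H^{⊗ (n+1)}`, `a ⊗ (a₁ ⊗ ⋯ ⊗ aₙ) ↦ a ⊗ a₁ ⊗ ⋯ ⊗ aₙ`. -/
def tensorCons (n : ℕ) : H ⊗[k] (⨂[k]^n H) →ₗ[k] (⨂[k]^(n + 1) H) :=
  TensorProduct.lift
    ((PiTensorProduct.lift (R := k) (s := fun _ : Fin n => H)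
        (E := ⨂[k]^(n + 1) H)).toLinearMap ∘ₗ
      (PiTensorProduct.tprod k (s := fun _ : Fin (n + 1) => H)).curryLeft)

/-- The iterated comultiplication `Δ⁽ⁿ⁾ : H → H^{⊗ n}`, `x ↦ x₍₁₎ ⊗ ⋯ ⊗ x₍ₙ₎`, defined by
`Δ⁽⁰⁾ = ε` (with `H^{⊗ 0}` the ground field) and `Δ⁽ⁿ⁺¹⁾ = (id ⊗ Δ⁽ⁿ⁾) ∘ Δ`. -/
def iteratedComul : (n : ℕ) → H →ₗ[k] (⨂[k]^n H)
  | 0 => (LinearMap.toSpanSingleton k (⨂[k]^0 H)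
      (PiTensorProduct.tprod k (fun _ : Fin 0 => (1 : H)))) ∘ₗ Coalgebra.counit
  | n + 1 => tensorCons k H n ∘ₗ (iteratedComul n).lTensor H ∘ₗ Coalgebra.comul

/-- The iterated product `m : H^{⊗ n} → H`, `a₁ ⊗ ⋯ ⊗ aₙ ↦ a₁ ⋯ aₙ` (in this order). -/
def iteratedMul (n : ℕ) : (⨂[k]^n H) →ₗ[k] H :=
  PiTensorProduct.lift (MultilinearMap.mkPiAlgebraFin k n H)

/-- The action of a permutation on tensors, `σ (v₁ ⊗ ⋯ ⊗ vₙ) = v_{σ 1} ⊗ ⋯ ⊗ v_{σ n}`. -/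
def permTensor {n : ℕ} (σ : Equiv.Perm (Fin n)) : (⨂[k]^n H) →ₗ[k] (⨂[k]^n H) :=
  (PiTensorProduct.reindex k (fun _ : Fin n => H) σ.symm).toLinearMap

theorem permTensor_tprod {n : ℕ} (σ : Equiv.Perm (Fin n)) (v : Fin n → H) :
    permTensor k H σ (PiTensorProduct.tprod k v) = PiTensorProduct.tprod k (fun t => v (σ t)) := by
  simp [permTensor]

theorem iteratedMul_tprod {n : ℕ} (v : Fin n → H) :
    iteratedMul k H n (PiTensorProduct.tprod k v) = (List.ofFn v).prod := by
  simp [iteratedMul]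

theorem tensorCons_tmul_tprod {n : ℕ} (a : H) (v : Fin n → H) :
    tensorCons k H n (a ⊗ₜ[k] PiTensorProduct.tprod k v) =
      PiTensorProduct.tprod k (Fin.cons a v : Fin (n + 1) → H) := by
  simp [tensorCons]

/-- The `n`-th Sweedler power `P⁽ⁿ⁾(x) = x₍₁₎ ⋯ x₍ₙ₎`. -/
def sweedlerPower (n : ℕ) : H →ₗ[k] H :=
  iteratedMul k H n ∘ₗ iteratedComul k H n

end Sweedler

/-! ### The permutation `σ_{(n,l)}` -/

section Shuffle

/-- For `i ∈ {1, …, n-1}` and `l` coprime to `n`, the residue of `i l` modulo `n`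
lies in `{1, …, n-1}`. -/
theorem shuffle_bounds {n : ℕ} {l : ℤ} (hl : IsCoprime (n : ℤ) l) (i : Fin (n - 1)) :
    1 ≤ (((i : ℕ) + 1 : ℤ) * l) % n ∧ (((i : ℕ) + 1 : ℤ) * l) % n < n := by
  have hi := i.2
  have hn : (0 : ℤ) < n := by omega
  have h0 := Int.emod_nonneg (((i : ℕ) + 1 : ℤ) * l) hn.ne'
  refine ⟨?_, Int.emod_lt_of_pos _ hn⟩
  by_contra hlt
  have hz : (((i : ℕ) + 1 : ℤ) * l) % n = 0 := by omega
  have hd : (n : ℤ) ∣ ((i : ℕ) + 1 : ℤ) := hl.dvd_of_dvd_mul_right (Int.dvd_of_emod_eq_zero hz)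
  have := Int.le_of_dvd (by omega) hd
  omega

/-- The map `i ↦ (residue of i l modulo n)` on `{1, …, n-1}`; the element `i` of
`{1, …, n-1}` is represented by `i - 1` in `Fin (n - 1)`. -/
def shuffleFun (n : ℕ) (l : ℤ) (hl : IsCoprime (n : ℤ) l) (i : Fin (n - 1)) : Fin (n - 1) :=
  ⟨((((i : ℕ) + 1 : ℤ) * l) % n).toNat - 1, by have := shuffle_bounds hl i; omega⟩

theorem shuffleFun_injective (n : ℕ) (l : ℤ) (hl : IsCoprime (n : ℤ) l) :
    Function.Injective (shuffleFun n l hl) := by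
  intro i j hij
  have h1 := shuffle_bounds hl i
  have h2 := shuffle_bounds hl j
  have h3 := congrArg Fin.val hij
  simp only [shuffleFun] at h3
  have h4 : (((i : ℕ) + 1 : ℤ) * l) % n = (((j : ℕ) + 1 : ℤ) * l) % n := by omega
  have h5 : (n : ℤ) ∣ (((j : ℕ) + 1 : ℤ) - ((i : ℕ) + 1 : ℤ)) * l := by
    rw [sub_mul]; exact Int.ModEq.dvd h4
  have h6 := hl.dvd_of_dvd_mul_right h5
  have hi := i.2
  have hj := j.2
  have h7 : ((j : ℕ) + 1 : ℤ) - ((i : ℕ) + 1 : ℤ) = 0 :=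
    Int.eq_zero_of_abs_lt_dvd h6 (by rw [abs_lt]; omega)
  exact Fin.ext (by omega)

/-- The permutation `σ_{(n,l)}` of `{1, …, n-1}`, `i ↦ (residue of i l modulo n)`, for `l`
coprime to `n`. -/
def shufflePerm (n : ℕ) (l : ℤ) (hl : IsCoprime (n : ℤ) l) : Equiv.Perm (Fin (n - 1)) :=
  Equiv.ofBijective (shuffleFun n l hl)
    (Finite.injective_iff_bijective.mp (shuffleFun_injective n l hl))

end Shuffle

section Indicator

variable (k : Type*) [Field k] (H : Type*) [Ring H] [HopfAlgebra k H]

/-- The shuffled Sweedler power `P̃⁽ⁿ'ˡ⁾ = m ∘ σ_{(n,l)} ∘ Δ⁽ⁿ⁻¹⁾`. -/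
def shuffledSweedlerPower (n : ℕ) (l : ℤ) (hl : IsCoprime (n : ℤ) l) : H →ₗ[k] H :=
  iteratedMul k H (n - 1) ∘ₗ permTensor k H (shufflePerm n l hl) ∘ₗ iteratedComul k H (n - 1)

/-- The invariant `ν̃_{n,l}(H) = Tr(S ∘ P̃⁽ⁿ'ˡ⁾)`. -/
def shuffledIndicator (n : ℕ) (l : ℤ) (hl : IsCoprime (n : ℤ) l) : k :=
  LinearMap.trace k H (HopfAlgebra.antipode k ∘ₗ shuffledSweedlerPower k H n l hl)

/-- The `n`-th indicator `ν_n(H) = Tr(S ∘ P⁽ⁿ⁻¹⁾)` of Kashina, Montgomery and Ng. -/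
def kmnIndicator (n : ℕ) : k :=
  LinearMap.trace k H (HopfAlgebra.antipode k ∘ₗ sweedlerPower k H (n - 1))

end Indicator

/-! ### 2-cocycles and Drinfeld twists -/

section Twist

variable {k : Type*} [Field k] {H : Type*} [Ring H] [HopfAlgebra k H]

/-- `a ⊗ b ↦ ε(a) b`. -/
def counitLeft (k : Type*) [Field k] (H : Type*) [Ring H] [HopfAlgebra k H] :
    H ⊗[k] H →ₐ[k] H :=
  (Algebra.TensorProduct.lid k H).toAlgHom.comp
    (Algebra.TensorProduct.map (Bialgebra.counitAlgHom k H) (AlgHom.id k H))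

/-- `a ⊗ b ↦ a ε(b)`. -/
def counitRight (k : Type*) [Field k] (H : Type*) [Ring H] [HopfAlgebra k H] :
    H ⊗[k] H →ₐ[k] H :=
  (Algebra.TensorProduct.rid k k H).toAlgHom.comp
    (Algebra.TensorProduct.map (AlgHom.id k H) (Bialgebra.counitAlgHom k H))

/-- `id ⊗ Δ : H ⊗ H → H ⊗ (H ⊗ H)`. -/
def comulRight (k : Type*) [Field k] (H : Type*) [Ring H] [HopfAlgebra k H] :
    H ⊗[k] H →ₐ[k] H ⊗[k] (H ⊗[k] H) :=
  Algebra.TensorProduct.map (AlgHom.id k H) (Bialgebra.comulAlgHom k H)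

/-- `Δ ⊗ id : H ⊗ H → (H ⊗ H) ⊗ H ≅ H ⊗ (H ⊗ H)`. -/
def comulLeft (k : Type*) [Field k] (H : Type*) [Ring H] [HopfAlgebra k H] :
    H ⊗[k] H →ₐ[k] H ⊗[k] (H ⊗[k] H) :=
  (Algebra.TensorProduct.assoc k k k H H H).toAlgHom.comp
    (Algebra.TensorProduct.map (Bialgebra.comulAlgHom k H) (AlgHom.id k H))

/-- `X ↦ 1 ⊗ X`. -/
def oneTmul (k : Type*) [Field k] (H : Type*) [Ring H] [HopfAlgebra k H] :
    H ⊗[k] H →ₐ[k] H ⊗[k] (H ⊗[k] H) :=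
  Algebra.TensorProduct.includeRight

/-- `X ↦ X ⊗ 1`, rebracketed. -/
def tmulOne (k : Type*) [Field k] (H : Type*) [Ring H] [HopfAlgebra k H] :
    H ⊗[k] H →ₐ[k] H ⊗[k] (H ⊗[k] H) :=
  (Algebra.TensorProduct.assoc k k k H H H).toAlgHom.comp
    Algebra.TensorProduct.includeLeft

/-- An invertible `F ∈ H ⊗ H` is a 2-cocycle if it is a gauge transformation, i.e.
`(ε ⊗ id)(F) = 1 = (id ⊗ ε)(F)`, and
`1 = (1 ⊗ F) (id ⊗ Δ)(F) (Δ ⊗ id)(F⁻¹) (F⁻¹ ⊗ 1)` in `H ⊗ H ⊗ H`. -/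
structure IsTwoCocycle (F : (H ⊗[k] H)ˣ) : Prop where
  counit_left : counitLeft k H F = 1
  counit_right : counitRight k H F = 1
  cocycle : 1 = oneTmul k H (F : H ⊗[k] H) * comulRight k H (F : H ⊗[k] H) *
    comulLeft k H ((F⁻¹ : (H ⊗[k] H)ˣ) : H ⊗[k] H) *
    tmulOne k H ((F⁻¹ : (H ⊗[k] H)ˣ) : H ⊗[k] H)

/-- The twisted comultiplication `Δ_F(h) = F Δ(h) F⁻¹`. -/
def twistComul (F : (H ⊗[k] H)ˣ) : H →ₐ[k] H ⊗[k] H :=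
  AlgHom.ofLinearMap
    (LinearMap.mulLeft k (F : H ⊗[k] H) ∘ₗ
      LinearMap.mulRight k ((F⁻¹ : (H ⊗[k] H)ˣ) : H ⊗[k] H) ∘ₗ Coalgebra.comul)
    (by simp)
    (by intro x y; simp [mul_assoc])

theorem twistComul_apply (F : (H ⊗[k] H)ˣ) (h : H) :
    twistComul F h = (F : H ⊗[k] H) * Coalgebra.comul h * ((F⁻¹ : (H ⊗[k] H)ˣ) : H ⊗[k] H) := by
  simp [twistComul, mul_assoc]

/-- `a ⊗ b ↦ S(a) c b`. -/
def antipodeLeft (c : H) : H ⊗[k] H →ₗ[k] H :=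
  LinearMap.mul' k H ∘ₗ
    TensorProduct.map (LinearMap.mulRight k c ∘ₗ HopfAlgebra.antipode k) LinearMap.id

/-- `a ⊗ b ↦ a c S(b)`. -/
def antipodeRight (c : H) : H ⊗[k] H →ₗ[k] H :=
  LinearMap.mul' k H ∘ₗ
    TensorProduct.map (LinearMap.mulRight k c) (HopfAlgebra.antipode k)

@[simp] theorem antipodeLeft_tmul (c a b : H) :
    antipodeLeft c (a ⊗ₜ[k] b) = HopfAlgebra.antipode k a * c * b := by
  simp [antipodeLeft]

@[simp] theorem antipodeRight_tmul (c a b : H) :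
    antipodeRight c (a ⊗ₜ[k] b) = a * c * HopfAlgebra.antipode k b := by
  simp [antipodeRight]

/-- `u = f¹ S(f²)` for `F = f¹ ⊗ f²`. -/
def twistU (F : (H ⊗[k] H)ˣ) : H := antipodeRight 1 (F : H ⊗[k] H)

/-- `u⁻¹ = S(d¹) d²` for `F⁻¹ = d¹ ⊗ d²`. -/
def twistUInv (F : (H ⊗[k] H)ˣ) : H := antipodeLeft 1 ((F⁻¹ : (H ⊗[k] H)ˣ) : H ⊗[k] H)

/-- The antipode `S_F(h) = u S(h) u⁻¹` of the twist. -/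
def twistAntipode (F : (H ⊗[k] H)ˣ) : H →ₗ[k] H :=
  LinearMap.mulLeft k (twistU F) ∘ₗ LinearMap.mulRight k (twistUInv F) ∘ₗ HopfAlgebra.antipode k

theorem twistAntipode_apply (F : (H ⊗[k] H)ˣ) (h : H) :
    twistAntipode F h = twistU F * HopfAlgebra.antipode k h * twistUInv F := by
  simp [twistAntipode, mul_assoc]

theorem antipodeLeft_mul (c : H) (X Y : H ⊗[k] H) :
    antipodeLeft c (X * Y) = antipodeLeft (antipodeLeft c X) Y := by
  induction Y using TensorProduct.induction_on with
  | zero => simp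
  | add Y₁ Y₂ h₁ h₂ => simp [mul_add, h₁, h₂]
  | tmul a b =>
    induction X using TensorProduct.induction_on with
    | zero => simp
    | add X₁ X₂ h₁ h₂ => rw [add_mul, map_add, h₁, h₂]; simp [mul_add, add_mul]
    | tmul x y => simp [HopfAlgebra.antipode_mul_antidistrib, mul_assoc]

theorem antipodeRight_mul (c : H) (X Y : H ⊗[k] H) :
    antipodeRight c (X * Y) = antipodeRight (antipodeRight c Y) X := by
  induction X using TensorProduct.induction_on with
  | zero => simp
  | add Y₁ Y₂ h₁ h₂ => simp [add_mul, h₁, h₂]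
  | tmul a b =>
    induction Y using TensorProduct.induction_on with
    | zero => simp
    | add X₁ X₂ h₁ h₂ => rw [mul_add, map_add, h₁, h₂]; simp [mul_add, add_mul]
    | tmul x y => simp [HopfAlgebra.antipode_mul_antidistrib, mul_assoc]

theorem antipodeLeft_comul (h : H) :
    antipodeLeft 1 (Coalgebra.comul (R := k) h) = algebraMap k H (Coalgebra.counit h) := by
  rw [← HopfAlgebra.mul_antipode_rTensor_comul_apply (R := k) h]
  simp [antipodeLeft, LinearMap.rTensor]

theorem antipodeRight_comul (h : H) :
    antipodeRight 1 (Coalgebra.comul (R := k) h) = algebraMap k H (Coalgebra.counit h) := by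
  rw [← HopfAlgebra.mul_antipode_lTensor_comul_apply (R := k) h]
  simp [antipodeRight, LinearMap.lTensor]

/-- `a ⊗ b ⊗ c ↦ a S(b) c`. -/
def contractOne (k : Type*) [Field k] (H : Type*) [Ring H] [HopfAlgebra k H] :
    H ⊗[k] (H ⊗[k] H) →ₗ[k] H :=
  LinearMap.mul' k H ∘ₗ (antipodeLeft 1).lTensor H

/-- `a ⊗ b ⊗ c ↦ S(a) b S(c)`. -/
def contractTwo (k : Type*) [Field k] (H : Type*) [Ring H] [HopfAlgebra k H] :
    H ⊗[k] (H ⊗[k] H) →ₗ[k] H :=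
  LinearMap.mul' k H ∘ₗ TensorProduct.map (HopfAlgebra.antipode k) (antipodeRight 1)

theorem contractOne_mul (x y : H) (Z W : H ⊗[k] H) :
    contractOne k H ((x ⊗ₜ[k] Z) * Algebra.TensorProduct.assoc k k k H H H (W ⊗ₜ[k] y)) =
      x * antipodeRight 1 W * antipodeLeft 1 Z * y := by
  induction W using TensorProduct.induction_on with
  | zero => simp
  | add W₁ W₂ h₁ h₂ => simp only [TensorProduct.add_tmul, map_add, mul_add, h₁, h₂, add_mul]
  | tmul a b => simp [contractOne, antipodeLeft_mul, mul_assoc]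

theorem contractTwo_mul (x y : H) (Z W : H ⊗[k] H) :
    contractTwo k H (Algebra.TensorProduct.assoc k k k H H H (W ⊗ₜ[k] y) * (x ⊗ₜ[k] Z)) =
      HopfAlgebra.antipode k x * antipodeLeft 1 W * antipodeRight 1 Z *
        HopfAlgebra.antipode k y := by
  induction W using TensorProduct.induction_on with
  | zero => simp
  | add W₁ W₂ h₁ h₂ => simp only [TensorProduct.add_tmul, map_add, mul_add, h₁, h₂, add_mul]
  | tmul a b =>
    simp [contractTwo, antipodeRight_mul, HopfAlgebra.antipode_mul_antidistrib, mul_assoc]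

theorem contractOne_comul (X Y : H ⊗[k] H) :
    contractOne k H (comulRight k H X * comulLeft k H Y) =
      counitRight k H X * counitLeft k H Y := by
  induction X using TensorProduct.induction_on with
  | zero => simp
  | add X₁ X₂ h₁ h₂ => simp only [map_add, add_mul, h₁, h₂]
  | tmul a b =>
    induction Y using TensorProduct.induction_on with
    | zero => simp
    | add X₁ X₂ h₁ h₂ => simp only [map_add, mul_add, h₁, h₂]
    | tmul c d =>
      have := contractOne_mul a d (Coalgebra.comul (R := k) b) (Coalgebra.comul (R := k) c)
      rw [antipodeLeft_comul, antipodeRight_comul] at this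
      simp [comulRight, comulLeft, counitRight, counitLeft, this, Algebra.algebraMap_eq_smul_one,
        smul_smul, mul_comm]

theorem contractTwo_comul (X Y : H ⊗[k] H) :
    contractTwo k H (comulLeft k H X * comulRight k H Y) =
      HopfAlgebra.antipode k (counitRight k H Y) * HopfAlgebra.antipode k (counitLeft k H X) := by
  induction X using TensorProduct.induction_on with
  | zero => simp
  | add X₁ X₂ h₁ h₂ => simp only [map_add, add_mul, mul_add, h₁, h₂]
  | tmul a b =>
    induction Y using TensorProduct.induction_on with
    | zero => simp
    | add X₁ X₂ h₁ h₂ => simp only [map_add, mul_add, add_mul, h₁, h₂]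
    | tmul c d =>
      have := contractTwo_mul c b (Coalgebra.comul (R := k) d) (Coalgebra.comul (R := k) a)
      rw [antipodeLeft_comul, antipodeRight_comul] at this
      simp [comulRight, comulLeft, counitRight, counitLeft, this, Algebra.algebraMap_eq_smul_one,
        smul_smul, mul_comm]

variable {F : (H ⊗[k] H)ˣ}

theorem IsTwoCocycle.comul_mul (hF : IsTwoCocycle F) :
    comulRight k H (F : H ⊗[k] H) * comulLeft k H ((F⁻¹ : (H ⊗[k] H)ˣ) : H ⊗[k] H) =
      oneTmul k H ((F⁻¹ : (H ⊗[k] H)ˣ) : H ⊗[k] H) * tmulOne k H (F : H ⊗[k] H) := by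
  have h := congrArg (fun t => oneTmul k H ((F⁻¹ : (H ⊗[k] H)ˣ) : H ⊗[k] H) * t *
    tmulOne k H (F : H ⊗[k] H)) hF.cocycle
  have h1 : oneTmul k H ((F⁻¹ : (H ⊗[k] H)ˣ) : H ⊗[k] H) * oneTmul k H (F : H ⊗[k] H) = 1 := by
    rw [← map_mul]; simp
  have h2 : tmulOne k H ((F⁻¹ : (H ⊗[k] H)ˣ) : H ⊗[k] H) * tmulOne k H (F : H ⊗[k] H) = 1 := by
    rw [← map_mul]; simp
  simp only [mul_one, mul_assoc, h2] at h
  rw [h, ← mul_assoc, ← mul_assoc, h1, one_mul]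

theorem IsTwoCocycle.assoc (hF : IsTwoCocycle F) :
    tmulOne k H (F : H ⊗[k] H) * comulLeft k H (F : H ⊗[k] H) =
      oneTmul k H (F : H ⊗[k] H) * comulRight k H (F : H ⊗[k] H) := by
  have h := congrArg (fun t => t * tmulOne k H (F : H ⊗[k] H) * comulLeft k H (F : H ⊗[k] H))
    hF.cocycle
  have h1 : comulLeft k H ((F⁻¹ : (H ⊗[k] H)ˣ) : H ⊗[k] H) * comulLeft k H (F : H ⊗[k] H) = 1 := by
    rw [← map_mul]; simp
  have h2 : tmulOne k H ((F⁻¹ : (H ⊗[k] H)ˣ) : H ⊗[k] H) * tmulOne k H (F : H ⊗[k] H) = 1 := by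
    rw [← map_mul]; simp
  rw [one_mul] at h
  rw [h, mul_assoc _ (tmulOne k H _) (tmulOne k H _), h2, mul_one, mul_assoc _ _
    (comulLeft k H _), h1, mul_one]

theorem IsTwoCocycle.assoc_inv (hF : IsTwoCocycle F) :
    comulLeft k H ((F⁻¹ : (H ⊗[k] H)ˣ) : H ⊗[k] H) * tmulOne k H ((F⁻¹ : (H ⊗[k] H)ˣ) : H ⊗[k] H) =
      comulRight k H ((F⁻¹ : (H ⊗[k] H)ˣ) : H ⊗[k] H) *
        oneTmul k H ((F⁻¹ : (H ⊗[k] H)ˣ) : H ⊗[k] H) := by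
  have h : Units.map (tmulOne k H).toMonoidHom F * Units.map (comulLeft k H).toMonoidHom F =
      Units.map (oneTmul k H).toMonoidHom F * Units.map (comulRight k H).toMonoidHom F :=
    Units.ext hF.assoc
  have h' := congrArg (fun t => ((t⁻¹ : (H ⊗[k] (H ⊗[k] H))ˣ) : H ⊗[k] (H ⊗[k] H))) h
  simp only [mul_inv_rev, ← map_inv] at h'
  exact h'

theorem IsTwoCocycle.mul_comul (hF : IsTwoCocycle F) :
    tmulOne k H ((F⁻¹ : (H ⊗[k] H)ˣ) : H ⊗[k] H) * oneTmul k H (F : H ⊗[k] H) =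
      comulLeft k H (F : H ⊗[k] H) * comulRight k H ((F⁻¹ : (H ⊗[k] H)ˣ) : H ⊗[k] H) := by
  have h := congrArg (fun t => tmulOne k H ((F⁻¹ : (H ⊗[k] H)ˣ) : H ⊗[k] H) * t *
    comulRight k H ((F⁻¹ : (H ⊗[k] H)ˣ) : H ⊗[k] H)) hF.assoc
  have h1 : comulRight k H (F : H ⊗[k] H) * comulRight k H ((F⁻¹ : (H ⊗[k] H)ˣ) : H ⊗[k] H) = 1 := by
    rw [← map_mul]; simp
  have h2 : tmulOne k H ((F⁻¹ : (H ⊗[k] H)ˣ) : H ⊗[k] H) * tmulOne k H (F : H ⊗[k] H) = 1 := by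
    rw [← map_mul]; simp
  simp only [mul_assoc, h1, mul_one] at h
  rw [← h, ← mul_assoc, h2, one_mul]

theorem IsTwoCocycle.counit_left_inv (hF : IsTwoCocycle F) :
    counitLeft k H ((F⁻¹ : (H ⊗[k] H)ˣ) : H ⊗[k] H) = 1 := by
  have h : counitLeft k H ((F : H ⊗[k] H) * ((F⁻¹ : (H ⊗[k] H)ˣ) : H ⊗[k] H)) = 1 := by simp
  rwa [map_mul, hF.counit_left, one_mul] at h

theorem IsTwoCocycle.counit_right_inv (hF : IsTwoCocycle F) :
    counitRight k H ((F⁻¹ : (H ⊗[k] H)ˣ) : H ⊗[k] H) = 1 := by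
  have h : counitRight k H ((F : H ⊗[k] H) * ((F⁻¹ : (H ⊗[k] H)ˣ) : H ⊗[k] H)) = 1 := by simp
  rwa [map_mul, hF.counit_right, one_mul] at h

theorem IsTwoCocycle.u_mul_uInv (hF : IsTwoCocycle F) : twistU F * twistUInv F = 1 := by
  have h := congrArg (contractOne k H) hF.comul_mul
  rw [contractOne_comul, hF.counit_right, hF.counit_left_inv] at h
  have h' := contractOne_mul 1 1 ((F⁻¹ : (H ⊗[k] H)ˣ) : H ⊗[k] H) (F : H ⊗[k] H)
  simp only [one_mul, mul_one] at h'
  exact h'.symm.trans (h.symm.trans (one_mul 1))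

theorem IsTwoCocycle.uInv_mul_u (hF : IsTwoCocycle F) : twistUInv F * twistU F = 1 := by
  have h := congrArg (contractTwo k H) hF.mul_comul
  rw [contractTwo_comul, hF.counit_left, hF.counit_right_inv] at h
  have h' := contractTwo_mul 1 1 (F : H ⊗[k] H) ((F⁻¹ : (H ⊗[k] H)ˣ) : H ⊗[k] H)
  simp only [one_mul, mul_one, HopfAlgebra.antipode_one] at h' h
  exact h'.symm.trans h

theorem antipodeLeft_algebraMap (r : k) (X : H ⊗[k] H) :
    antipodeLeft (algebraMap k H r) X = r • antipodeLeft 1 X := by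
  induction X using TensorProduct.induction_on with
  | zero => simp
  | add X₁ X₂ h₁ h₂ => simp only [map_add, h₁, h₂, smul_add]
  | tmul a b => simp [Algebra.algebraMap_eq_smul_one]

theorem antipodeRight_algebraMap (r : k) (X : H ⊗[k] H) :
    antipodeRight (algebraMap k H r) X = r • antipodeRight 1 X := by
  induction X using TensorProduct.induction_on with
  | zero => simp
  | add X₁ X₂ h₁ h₂ => simp only [map_add, h₁, h₂, smul_add]
  | tmul a b => simp [Algebra.algebraMap_eq_smul_one]

theorem mul_twistAntipode_left (X : H ⊗[k] H) :
    LinearMap.mul' k H ((twistAntipode F).rTensor H X) =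
      twistU F * antipodeLeft (twistUInv F) X := by
  induction X using TensorProduct.induction_on with
  | zero => simp
  | add X₁ X₂ h₁ h₂ => simp only [map_add, h₁, h₂, mul_add]
  | tmul a b => simp [twistAntipode_apply, mul_assoc]

theorem mul_twistAntipode_right (X : H ⊗[k] H) :
    LinearMap.mul' k H ((twistAntipode F).lTensor H X) =
      antipodeRight (twistU F) X * twistUInv F := by
  induction X using TensorProduct.induction_on with
  | zero => simp
  | add X₁ X₂ h₁ h₂ => simp only [map_add, h₁, h₂, add_mul]
  | tmul a b => simp [twistAntipode_apply, mul_assoc]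

theorem IsTwoCocycle.antipode_left (hF : IsTwoCocycle F) (h : H) :
    LinearMap.mul' k H ((twistAntipode F).rTensor H (twistComul F h)) =
      algebraMap k H (Coalgebra.counit h) := by
  have h1 : antipodeLeft (twistUInv F) (F : H ⊗[k] H) = 1 := by
    rw [twistUInv, ← antipodeLeft_mul, Units.inv_mul, Algebra.TensorProduct.one_def]
    simp
  rw [mul_twistAntipode_left, twistComul_apply, antipodeLeft_mul, antipodeLeft_mul, h1,
    antipodeLeft_comul, antipodeLeft_algebraMap, ← twistUInv, mul_smul_comm, hF.u_mul_uInv,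
    Algebra.algebraMap_eq_smul_one]

theorem IsTwoCocycle.antipode_right (hF : IsTwoCocycle F) (h : H) :
    LinearMap.mul' k H ((twistAntipode F).lTensor H (twistComul F h)) =
      algebraMap k H (Coalgebra.counit h) := by
  have h1 : antipodeRight (twistU F) ((F⁻¹ : (H ⊗[k] H)ˣ) : H ⊗[k] H) = 1 := by
    rw [twistU, ← antipodeRight_mul, Units.inv_mul, Algebra.TensorProduct.one_def]
    simp
  rw [mul_twistAntipode_right, twistComul_apply, antipodeRight_mul, h1, antipodeRight_mul,
    antipodeRight_comul, antipodeRight_algebraMap, ← twistU, smul_mul_assoc, hF.u_mul_uInv,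
    Algebra.algebraMap_eq_smul_one]

theorem assoc_map_twistComul (X : H ⊗[k] H) :
    Algebra.TensorProduct.assoc k k k H H H
        (Algebra.TensorProduct.map (twistComul F) (AlgHom.id k H) X) =
      tmulOne k H (F : H ⊗[k] H) * comulLeft k H X *
        tmulOne k H ((F⁻¹ : (H ⊗[k] H)ˣ) : H ⊗[k] H) := by
  induction X using TensorProduct.induction_on with
  | zero => simp
  | add X₁ X₂ h₁ h₂ => simp only [map_add, h₁, h₂, add_mul, mul_add]
  | tmul a b =>
    simp only [tmulOne, comulLeft, AlgHom.comp_apply, ← map_mul]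
    simp [twistComul_apply]

theorem map_id_twistComul (X : H ⊗[k] H) :
    Algebra.TensorProduct.map (AlgHom.id k H) (twistComul F) X =
      oneTmul k H (F : H ⊗[k] H) * comulRight k H X *
        oneTmul k H ((F⁻¹ : (H ⊗[k] H)ˣ) : H ⊗[k] H) := by
  induction X using TensorProduct.induction_on with
  | zero => simp
  | add X₁ X₂ h₁ h₂ => simp only [map_add, h₁, h₂, add_mul, mul_add]
  | tmul a b => simp [oneTmul, comulRight, twistComul_apply]

theorem comulLeft_comul (h : H) :
    comulLeft k H (Coalgebra.comul (R := k) h) = comulRight k H (Coalgebra.comul (R := k) h) :=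
  Coalgebra.coassoc_apply (R := k) h

theorem IsTwoCocycle.twist_coassoc (hF : IsTwoCocycle F) :
    (Algebra.TensorProduct.assoc k k k H H H).toAlgHom.comp
        ((Algebra.TensorProduct.map (twistComul F) (AlgHom.id k H)).comp (twistComul F)) =
      (Algebra.TensorProduct.map (AlgHom.id k H) (twistComul F)).comp (twistComul F) := by
  ext h
  change Algebra.TensorProduct.assoc k k k H H H
      (Algebra.TensorProduct.map (twistComul F) (AlgHom.id k H) (twistComul F h)) =
    Algebra.TensorProduct.map (AlgHom.id k H) (twistComul F) (twistComul F h)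
  rw [assoc_map_twistComul, map_id_twistComul, twistComul_apply]
  simp only [map_mul]
  rw [comulLeft_comul, ← mul_assoc, ← mul_assoc, hF.assoc, mul_assoc _ _ (tmulOne k H _),
    hF.assoc_inv]
  simp only [mul_assoc]

theorem counitLeft_comul (h : H) : counitLeft k H (Coalgebra.comul (R := k) h) = h := by
  refine (congrArg (TensorProduct.lid k H) (Coalgebra.rTensor_counit_comul (R := k) h)).trans ?_
  simp

theorem counitRight_comul (h : H) : counitRight k H (Coalgebra.comul (R := k) h) = h := by
  refine (congrArg (TensorProduct.rid k H) (Coalgebra.lTensor_counit_comul (R := k) h)).trans ?_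
  simp

theorem IsTwoCocycle.twist_counit_left (hF : IsTwoCocycle F) :
    (Algebra.TensorProduct.map (Bialgebra.counitAlgHom k H) (AlgHom.id k H)).comp (twistComul F) =
      ((Algebra.TensorProduct.lid k H).symm : H →ₐ[k] k ⊗[k] H) := by
  ext h
  apply (Algebra.TensorProduct.lid k H).injective
  change counitLeft k H (twistComul F h) = Algebra.TensorProduct.lid k H
    ((Algebra.TensorProduct.lid k H).symm h)
  rw [AlgEquiv.apply_symm_apply, twistComul_apply, map_mul, map_mul, hF.counit_left,
    hF.counit_left_inv, counitLeft_comul, one_mul, mul_one]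

theorem IsTwoCocycle.twist_counit_right (hF : IsTwoCocycle F) :
    (Algebra.TensorProduct.map (AlgHom.id k H) (Bialgebra.counitAlgHom k H)).comp (twistComul F) =
      ((Algebra.TensorProduct.rid k k H).symm : H →ₐ[k] H ⊗[k] k) := by
  ext h
  apply (Algebra.TensorProduct.rid k k H).injective
  change counitRight k H (twistComul F h) = Algebra.TensorProduct.rid k k H
    ((Algebra.TensorProduct.rid k k H).symm h)
  rw [AlgEquiv.apply_symm_apply, twistComul_apply, map_mul, map_mul, hF.counit_right,
    hF.counit_right_inv, counitRight_comul, one_mul, mul_one]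

/-- The underlying space of the Drinfeld twist `H_F` of `H` by a 2-cocycle `F`; it is `H`. -/
def DrinfeldTwist (F : (H ⊗[k] H)ˣ) (_hF : IsTwoCocycle F) : Type _ := H

/-- `H_F = H` as a ring. -/
instance (hF : IsTwoCocycle F) : Ring (DrinfeldTwist F hF) := inferInstanceAs (Ring H)

/-- `H_F = H` as an algebra. -/
instance DrinfeldTwist.instAlgebra (hF : IsTwoCocycle F) : Algebra k (DrinfeldTwist F hF) :=
  inferInstanceAs (Algebra k H)

/-- The bialgebra `H_F`: the comultiplication is `Δ_F(h) = F Δ(h) F⁻¹`, the counit is `ε`. -/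
instance DrinfeldTwist.instBialgebra (hF : IsTwoCocycle F) : Bialgebra k (DrinfeldTwist F hF) :=
  Bialgebra.ofAlgHom (R := k) (A := DrinfeldTwist F hF) (twistComul (H := H) F)
    (Bialgebra.counitAlgHom k H) hF.twist_coassoc hF.twist_counit_left hF.twist_counit_right

/-- The Hopf algebra `H_F`, with antipode `S_F(h) = u S(h) u⁻¹`. -/
instance DrinfeldTwist.instHopfAlgebra (hF : IsTwoCocycle F) :
    HopfAlgebra k (DrinfeldTwist F hF) where
  antipode := twistAntipode (H := H) F
  mul_antipode_rTensor_comul := LinearMap.ext (IsTwoCocycle.antipode_left (H := H) hF)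
  mul_antipode_lTensor_comul := LinearMap.ext (IsTwoCocycle.antipode_right (H := H) hF)

theorem DrinfeldTwist.comul_eq (hF : IsTwoCocycle F) (h : H) :
    Coalgebra.comul (R := k) (A := DrinfeldTwist F hF) h =
      (F : H ⊗[k] H) * Coalgebra.comul (R := k) h * ((F⁻¹ : (H ⊗[k] H)ˣ) : H ⊗[k] H) :=
  twistComul_apply F h

theorem DrinfeldTwist.counit_eq (hF : IsTwoCocycle F) (h : H) :
    Coalgebra.counit (R := k) (A := DrinfeldTwist F hF) h = Coalgebra.counit (R := k) h := rfl

theorem DrinfeldTwist.antipode_eq (hF : IsTwoCocycle F) (h : H) :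
    HopfAlgebra.antipode k (A := DrinfeldTwist F hF) h =
      twistU F * HopfAlgebra.antipode k h * twistUInv F :=
  twistAntipode_apply F h

end Twist

end

/-! Put N = n - 1. Twisting conjugates Δ⁽ᴺ⁾ by the iterated cocycle F⁽ᴺ⁾ (`IsTwistBy.convList_comp`)
and conjugates S by u. The trace is computed in A = H^{⊗ n}, which has one slot more than there are
Sweedler factors. There m(X (t ⊗ 1)) = m((1 ⊗ t) X), so the inverse cocycle on the right of Δ⁽ᴺ⁾ can
be moved to the left, shifted by one slot.

Let τ(X) = Tr(h ↦ S(m(X D(h)))), where D is the permuted Δ⁽ᴺ⁾ in the first N slots. Cyclicity of the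
trace converts u and u⁻¹ into outer factors F and F⁻¹ that use the extra slot
(`IsProductLike.antipodeTrace_mul`). The twisted trace becomes τ(F'⁻¹ F''), where F'' and F' are
iterated cocycles of full length n, read in the orders "permuted slots, then the last" and "the
first, then the permuted slots shifted by one". The same lemma with Δ(v) in place of F or F⁻¹ makes
τ invariant under right and left multiplication by Δ⁽ⁿ⁾ in these respective orders.

For i ↦ il mod n the two orders are cyclic rotations of each other (`rotatesSlots_shufflePerm`), say
PQ and QP. The cocycle identity reduces F'⁻¹ F'' to (Q ⊗ P)(F⁻¹) (P ⊗ Q)(F), and invariance replaces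
Q by P ∘ S. What remains is τ(P(u⁻¹u)) = τ(1), the untwisted trace
(`IsTwoCocycle.apply_cocycle_rotate`).

Slots are encoded as lists of algebra maps H → A with commuting images, so that reordering slots is
reordering a list. -/

noncomputable section

/-! ### Convolution products of algebra maps. -/

section Convolution

variable {k : Type*} [Field k] {H : Type*} [Ring H] [HopfAlgebra k H]
  {A : Type*} [Ring A] [Algebra k A] {B : Type*} [Ring B] [Algebra k B]

/-- `a ⊗ b ↦ f(a) g(b)`. -/
def tensorMul (f g : H →ₗ[k] A) : H ⊗[k] H →ₗ[k] A :=
  LinearMap.mul' k A ∘ₗ TensorProduct.map f g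

@[simp] theorem tensorMul_tmul (f g : H →ₗ[k] A) (a b : H) :
    tensorMul f g (a ⊗ₜ[k] b) = f a * g b := by
  simp [tensorMul]

theorem tensorMul_mul {f g : H →ₗ[k] A} (hf : ∀ x y, f (x * y) = f x * f y)
    (hg : ∀ x y, g (x * y) = g x * g y) (hfg : ∀ x y, Commute (f x) (g y)) (X Y : H ⊗[k] H) :
    tensorMul f g (X * Y) = tensorMul f g X * tensorMul f g Y := by
  induction X using TensorProduct.induction_on with
  | zero => simp
  | add X₁ X₂ h₁ h₂ => simp only [add_mul, map_add, h₁, h₂]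
  | tmul a b =>
    induction Y using TensorProduct.induction_on with
    | zero => simp
    | add Y₁ Y₂ h₁ h₂ => simp only [mul_add, map_add, h₁, h₂]
    | tmul c d =>
      simp only [Algebra.TensorProduct.tmul_mul_tmul, tensorMul_tmul, hf, hg]
      rw [mul_assoc, ← mul_assoc (f c), (hfg c b).eq, mul_assoc, mul_assoc]

theorem tensorMul_one {f g : H →ₗ[k] A} (hf : f 1 = 1) (hg : g 1 = 1) :
    tensorMul f g 1 = 1 := by
  rw [Algebra.TensorProduct.one_def, tensorMul_tmul, hf, hg, one_mul]

theorem commute_tensorMul {f g : H →ₗ[k] A} {c : A} (hf : ∀ x, Commute c (f x))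
    (hg : ∀ x, Commute c (g x)) (X : H ⊗[k] H) : Commute c (tensorMul f g X) := by
  induction X using TensorProduct.induction_on with
  | zero => simp
  | add X₁ X₂ h₁ h₂ => rw [map_add]; exact h₁.add_right h₂
  | tmul a b => rw [tensorMul_tmul]; exact (hf a).mul_right (hg b)

theorem map_tensorMul (φ : A →ₐ[k] B) (f g : H →ₗ[k] A) (X : H ⊗[k] H) :
    φ (tensorMul f g X) = tensorMul (φ.toLinearMap ∘ₗ f) (φ.toLinearMap ∘ₗ g) X := by
  induction X using TensorProduct.induction_on with
  | zero => simp
  | add X₁ X₂ h₁ h₂ => simp only [map_add, h₁, h₂]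
  | tmul a b => simp

/-- The convolution product of a list of algebra maps `g₁, …, gₙ`, that is
`x ↦ g₁(x₍₁₎) ⋯ gₙ(x₍ₙ₎)`. -/
def convList (L : List (H →ₐ[k] A)) : H →ₗ[k] A :=
  (L.map fun g => WithConv.toConv g.toLinearMap).prod.ofConv

@[simp] theorem convList_nil (x : H) :
    convList ([] : List (H →ₐ[k] A)) x = algebraMap k A (Coalgebra.counit x) := rfl

/-- Generalized coassociativity: it is absorbed into the associativity of the convolution ring,
after which the formula is definitional. -/
theorem convList_append (L M : List (H →ₐ[k] A)) (x : H) :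
    convList (L ++ M) x = tensorMul (convList L) (convList M) (Coalgebra.comul x) := by
  rw [convList, List.map_append, List.prod_append]
  rfl

@[simp] theorem convList_singleton (g : H →ₐ[k] A) : convList [g] = g.toLinearMap := by
  simp [convList]

theorem convList_cons (g : H →ₐ[k] A) (L : List (H →ₐ[k] A)) (x : H) :
    convList (g :: L) x = tensorMul g.toLinearMap (convList L) (Coalgebra.comul x) := by
  rw [← List.singleton_append, convList_append, convList_singleton]

theorem commute_convList {c : A} {L : List (H →ₐ[k] A)} (h : ∀ g ∈ L, ∀ x, Commute c (g x))
    (x : H) : Commute c (convList L x) := by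
  induction L generalizing x with
  | nil => exact (Algebra.commutes _ _).symm
  | cons g L ih =>
    rw [convList_cons]
    exact commute_tensorMul (h g (by simp)) (fun x => ih (fun g hg => h g (by simp [hg])) x) _

theorem map_convList (φ : A →ₐ[k] B) (L : List (H →ₐ[k] A)) (x : H) :
    φ (convList L x) = convList (L.map φ.comp) x := by
  induction L generalizing x with
  | nil => simp
  | cons g L ih =>
    rw [convList_cons, map_tensorMul, List.map_cons, convList_cons]
    congr 2
    exact LinearMap.ext ih

/-- Algebra maps with pairwise commuting images. -/
def CommutingImages (L : List (H →ₐ[k] A)) : Prop :=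
  L.Pairwise fun g g' => ∀ x y, Commute (g x) (g' y)

theorem CommutingImages.commute_convList {L M : List (H →ₐ[k] A)} (h : CommutingImages (L ++ M))
    (x y : H) : Commute (convList L x) (convList M y) :=
  _root_.commute_convList (fun g hg y => (_root_.commute_convList (fun f hf x =>
    ((List.pairwise_append.1 h).2.2 f hf g hg x y).symm) x).symm) y

theorem CommutingImages.cons_commute {g : H →ₐ[k] A} {L : List (H →ₐ[k] A)}
    (h : CommutingImages (g :: L)) (x y : H) : Commute (g x) (convList L y) := by
  simpa using CommutingImages.commute_convList (L := [g]) h x y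

theorem convList_one {L : List (H →ₐ[k] A)} : convList L 1 = 1 := by
  induction L with
  | nil => simp
  | cons g L ih =>
    rw [convList_cons, Bialgebra.comul_one]
    exact tensorMul_one (map_one g) ih

/-- Δ is multiplicative, and factors in different slots can be interchanged because the images
commute. -/
theorem CommutingImages.convList_mul {L : List (H →ₐ[k] A)} (hL : CommutingImages L) (x y : H) :
    convList L (x * y) = convList L x * convList L y := by
  induction L generalizing x y with
  | nil => simp
  | cons g L ih =>
    simp only [convList_cons, Bialgebra.comul_mul]
    exact tensorMul_mul (map_mul g) (ih (List.pairwise_cons.1 hL).2) hL.cons_commute _ _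

end Convolution

/-! ### Iterated cocycles and the iterated comultiplication of a twist. -/

section IteratedCocycle

variable {k : Type*} [Field k] {H : Type*} [Ring H] [HopfAlgebra k H]
  {A : Type*} [Ring A] [Algebra k A] {B : Type*} [Ring B] [Algebra k B]

/-- The iterated cocycle `F⁽ⁿ⁾ = (1 ⊗ F⁽ⁿ⁻¹⁾) (id ⊗ Δ⁽ⁿ⁻¹⁾)(F)`, read in the positions given by
a list of algebra maps. -/
def iteratedCocycle (F : (H ⊗[k] H)ˣ) : List (H →ₐ[k] A) → A
  | [] => 1
  | g :: L => iteratedCocycle F L * tensorMul g.toLinearMap (convList L) (F : H ⊗[k] H)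

/-- The inverse of the iterated cocycle. -/
def iteratedCocycleInv (F : (H ⊗[k] H)ˣ) : List (H →ₐ[k] A) → A
  | [] => 1
  | g :: L => tensorMul g.toLinearMap (convList L) ((F⁻¹ : (H ⊗[k] H)ˣ) : H ⊗[k] H) *
      iteratedCocycleInv F L

variable {F : (H ⊗[k] H)ˣ}

theorem CommutingImages.tensorMul_cons_mul {g : H →ₐ[k] A} {L : List (H →ₐ[k] A)}
    (hL : CommutingImages (g :: L)) (X Y : H ⊗[k] H) :
    tensorMul g.toLinearMap (convList L) (X * Y) =
      tensorMul g.toLinearMap (convList L) X * tensorMul g.toLinearMap (convList L) Y :=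
  tensorMul_mul (map_mul g) (CommutingImages.convList_mul (List.pairwise_cons.1 hL).2)
    hL.cons_commute X Y

theorem CommutingImages.tensorMul_append_mul {L M : List (H →ₐ[k] A)}
    (hL : CommutingImages (L ++ M)) (X Y : H ⊗[k] H) :
    tensorMul (convList L) (convList M) (X * Y) =
      tensorMul (convList L) (convList M) X * tensorMul (convList L) (convList M) Y :=
  tensorMul_mul (CommutingImages.convList_mul (List.pairwise_append.1 hL).1)
    (CommutingImages.convList_mul (List.pairwise_append.1 hL).2.1) hL.commute_convList X Y

theorem CommutingImages.cocycle_mul_inv {L : List (H →ₐ[k] A)} (hL : CommutingImages L) :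
    iteratedCocycle F L * iteratedCocycleInv F L = 1 := by
  induction L with
  | nil => simp [iteratedCocycle, iteratedCocycleInv]
  | cons g L ih =>
    rw [iteratedCocycle, iteratedCocycleInv, mul_assoc, ← mul_assoc (tensorMul _ _ _),
      ← hL.tensorMul_cons_mul, Units.mul_inv, tensorMul_one (map_one g) convList_one, one_mul,
      ih (List.pairwise_cons.1 hL).2]

theorem CommutingImages.cocycle_inv_mul {L : List (H →ₐ[k] A)} (hL : CommutingImages L) :
    iteratedCocycleInv F L * iteratedCocycle F L = 1 := by
  induction L with
  | nil => simp [iteratedCocycle, iteratedCocycleInv]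
  | cons g L ih =>
    rw [iteratedCocycle, iteratedCocycleInv, mul_assoc, ← mul_assoc (iteratedCocycleInv F L),
      ih (List.pairwise_cons.1 hL).2, one_mul, ← hL.tensorMul_cons_mul, Units.inv_mul,
      tensorMul_one (map_one g) convList_one]

theorem commute_iteratedCocycle {c : A} {L : List (H →ₐ[k] A)}
    (h : ∀ g ∈ L, ∀ x, Commute c (g x)) : Commute c (iteratedCocycle F L) := by
  induction L with
  | nil => exact Commute.one_right c
  | cons g L ih =>
    have h' : ∀ g ∈ L, ∀ x, Commute c (g x) := fun g hg => h g (by simp [hg])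
    exact (ih h').mul_right (commute_tensorMul (h g (by simp)) (commute_convList h') _)

theorem map_iteratedCocycle (φ : A →ₐ[k] B) (L : List (H →ₐ[k] A)) :
    φ (iteratedCocycle F L) = iteratedCocycle F (L.map φ.comp) := by
  induction L with
  | nil => simp [iteratedCocycle]
  | cons g L ih =>
    simp only [iteratedCocycle, map_mul, ih, map_tensorMul, List.map_cons]
    congr 3
    exact LinearMap.ext (map_convList φ L)

theorem map_iteratedCocycleInv (φ : A →ₐ[k] B) (L : List (H →ₐ[k] A)) :
    φ (iteratedCocycleInv F L) = iteratedCocycleInv F (L.map φ.comp) := by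
  induction L with
  | nil => simp [iteratedCocycleInv]
  | cons g L ih =>
    simp only [iteratedCocycleInv, map_mul, ih, map_tensorMul, List.map_cons]
    congr 3
    exact LinearMap.ext (map_convList φ L)

/-- `a ⊗ b ⊗ c ↦ f(a) g(b) h(c)`. -/
def tensorMul₃ (f g h : H →ₗ[k] A) : H ⊗[k] (H ⊗[k] H) →ₗ[k] A :=
  LinearMap.mul' k A ∘ₗ TensorProduct.map f (tensorMul g h)

@[simp] theorem tensorMul₃_tmul (f g h : H →ₗ[k] A) (a : H) (X : H ⊗[k] H) :
    tensorMul₃ f g h (a ⊗ₜ[k] X) = f a * tensorMul g h X := by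
  simp [tensorMul₃]

theorem tensorMul₃_assoc (f g h : H →ₗ[k] A) (X : H ⊗[k] H) (c : H) :
    tensorMul₃ f g h (Algebra.TensorProduct.assoc k k k H H H (X ⊗ₜ[k] c)) =
      tensorMul f g X * h c := by
  induction X using TensorProduct.induction_on with
  | zero => simp
  | add X₁ X₂ h₁ h₂ => simp only [TensorProduct.add_tmul, map_add, add_mul, h₁, h₂]
  | tmul a b => simp [mul_assoc]

theorem tensorMul₃_mul {f g h : H →ₗ[k] A} (hf : ∀ x y, f (x * y) = f x * f y)
    (hg : ∀ x y, g (x * y) = g x * g y) (hh : ∀ x y, h (x * y) = h x * h y)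
    (hfg : ∀ x y, Commute (f x) (g y)) (hfh : ∀ x y, Commute (f x) (h y))
    (hgh : ∀ x y, Commute (g x) (h y)) (X Y : H ⊗[k] (H ⊗[k] H)) :
    tensorMul₃ f g h (X * Y) = tensorMul₃ f g h X * tensorMul₃ f g h Y := by
  induction X using TensorProduct.induction_on with
  | zero => simp
  | add X₁ X₂ h₁ h₂ => simp only [add_mul, map_add, h₁, h₂]
  | tmul a b =>
    induction Y using TensorProduct.induction_on with
    | zero => simp
    | add Y₁ Y₂ h₁ h₂ => simp only [mul_add, map_add, h₁, h₂]
    | tmul c d =>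
      simp only [Algebra.TensorProduct.tmul_mul_tmul, tensorMul₃_tmul, hf, tensorMul_mul hg hh hgh]
      rw [mul_assoc, ← mul_assoc (f c), (commute_tensorMul (hfg c) (hfh c) b).eq, mul_assoc,
        mul_assoc]

/-- The cocycle identity (1 ⊗ F)(id ⊗ Δ)(F) = (F ⊗ 1)(Δ ⊗ id)(F), pushed to A by the multiplicative
map g ⊗ L ⊗ M. The facts `e1` to `e4` identify the images of its four factors. -/
theorem IsTwoCocycle.tensorMul_append_cons (hF : IsTwoCocycle F) {g : H →ₐ[k] A}
    {L M : List (H →ₐ[k] A)} (h : CommutingImages (g :: (L ++ M))) :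
    tensorMul (convList L) (convList M) (F : H ⊗[k] H) *
        tensorMul g.toLinearMap (convList (L ++ M)) (F : H ⊗[k] H) =
      tensorMul g.toLinearMap (convList L) (F : H ⊗[k] H) *
        tensorMul (convList (g :: L)) (convList M) (F : H ⊗[k] H) := by
  have hLM : CommutingImages (L ++ M) := (List.pairwise_cons.1 h).2
  have hL : CommutingImages (g :: L) :=
    (List.pairwise_append.1 (show CommutingImages ((g :: L) ++ M) from h)).1
  have hM : CommutingImages (g :: M) := by
    refine List.Pairwise.sublist ?_ h
    simp
  have e1 : ∀ X : H ⊗[k] H, tensorMul₃ g.toLinearMap (convList L) (convList M) (oneTmul k H X) =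
      tensorMul (convList L) (convList M) X := fun X => by simp [oneTmul]
  have e2 : ∀ X : H ⊗[k] H, tensorMul₃ g.toLinearMap (convList L) (convList M) (tmulOne k H X) =
      tensorMul g.toLinearMap (convList L) X := fun X => by
    simp only [tmulOne, AlgHom.comp_apply, Algebra.TensorProduct.includeLeft_apply]
    refine (tensorMul₃_assoc _ _ _ X 1).trans ?_
    rw [convList_one, mul_one]
  have e3 : ∀ X : H ⊗[k] H, tensorMul₃ g.toLinearMap (convList L) (convList M) (comulRight k H X) =
      tensorMul g.toLinearMap (convList (L ++ M)) X := fun X => by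
    induction X using TensorProduct.induction_on with
    | zero => simp
    | add X₁ X₂ h₁ h₂ => simp only [map_add, h₁, h₂]
    | tmul a b => simp [comulRight, convList_append]
  have e4 : ∀ X : H ⊗[k] H, tensorMul₃ g.toLinearMap (convList L) (convList M) (comulLeft k H X) =
      tensorMul (convList (g :: L)) (convList M) X := fun X => by
    induction X using TensorProduct.induction_on with
    | zero => simp
    | add X₁ X₂ h₁ h₂ => simp only [map_add, h₁, h₂]
    | tmul a b =>
      rw [tensorMul_tmul, convList_cons]
      exact tensorMul₃_assoc _ _ _ _ b
  have hm := tensorMul₃_mul (f := g.toLinearMap) (g := convList L) (h := convList M) (map_mul g)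
    (CommutingImages.convList_mul (List.pairwise_cons.1 hL).2)
    (CommutingImages.convList_mul (List.pairwise_cons.1 hM).2) hL.cons_commute hM.cons_commute
    hLM.commute_convList
  rw [← e1, ← e3, ← e2, ← e4, ← hm, ← hm, hF.assoc]

/-- The iterated cocycle does not depend on the bracketing: it may be split at any point, not only
after the first slot. The empty list uses the counit normalization of F, the induction step the
cocycle identity. -/
theorem IsTwoCocycle.iteratedCocycle_append (hF : IsTwoCocycle F) {L M : List (H →ₐ[k] A)}
    (h : CommutingImages (L ++ M)) :
    iteratedCocycle F (L ++ M) = iteratedCocycle F L * iteratedCocycle F M *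
      tensorMul (convList L) (convList M) (F : H ⊗[k] H) := by
  induction L with
  | nil =>
    have : ∀ X : H ⊗[k] H, tensorMul (convList ([] : List (H →ₐ[k] A))) (convList M) X =
        convList M (counitLeft k H X) := fun X => by
      induction X using TensorProduct.induction_on with
      | zero => simp
      | add X₁ X₂ h₁ h₂ => simp only [map_add, h₁, h₂]
      | tmul a b => simp [counitLeft, ← Algebra.smul_def]
    simp [this, hF.counit_left, convList_one, iteratedCocycle]
  | cons g L ih =>
    have h' := (List.pairwise_append.1 (show CommutingImages ((g :: L) ++ M) from h)).2.2
    have hc : Commute (iteratedCocycle F M)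
        (tensorMul g.toLinearMap (convList L) (F : H ⊗[k] H)) := by
      refine (commute_iteratedCocycle fun f hf x => (commute_tensorMul (fun y => ?_)
        (fun y => commute_convList (fun e he z => ?_) y) _).symm).symm
      · exact (h' g (by simp) f hf y x).symm
      · exact (h' e (by simp [he]) f hf z x).symm
    rw [List.cons_append, iteratedCocycle, ih (List.pairwise_cons.1 h).2, mul_assoc,
      hF.tensorMul_append_cons h, iteratedCocycle, mul_assoc, ← mul_assoc (iteratedCocycle F M),
      hc.eq]
    simp only [mul_assoc]

/-- By uniqueness of inverses this follows from the splitting of the cocycle itself. -/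
theorem IsTwoCocycle.iteratedCocycleInv_append (hF : IsTwoCocycle F) {L M : List (H →ₐ[k] A)}
    (h : CommutingImages (L ++ M)) :
    iteratedCocycleInv F (L ++ M) =
      tensorMul (convList L) (convList M) ((F⁻¹ : (H ⊗[k] H)ˣ) : H ⊗[k] H) *
        iteratedCocycleInv F M * iteratedCocycleInv F L := by
  have h1 := (List.pairwise_append.1 h).1
  have h2 := (List.pairwise_append.1 h).2.1
  refine (left_inv_eq_right_inv (a := iteratedCocycle F (L ++ M)) ?_ h.cocycle_mul_inv).symm
  rw [hF.iteratedCocycle_append h]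
  have e1 : iteratedCocycleInv F L * iteratedCocycle F L = 1 :=
    CommutingImages.cocycle_inv_mul h1
  have e2 : iteratedCocycleInv F M * iteratedCocycle F M = 1 :=
    CommutingImages.cocycle_inv_mul h2
  calc _ = tensorMul (convList L) (convList M) ((F⁻¹ : (H ⊗[k] H)ˣ) : H ⊗[k] H) *
        (iteratedCocycleInv F M * (iteratedCocycleInv F L * iteratedCocycle F L) *
          iteratedCocycle F M) * tensorMul (convList L) (convList M) (F : H ⊗[k] H) := by
        simp only [mul_assoc]
    _ = 1 := by
        rw [e1, mul_one, e2, mul_one, ← h.tensorMul_append_mul, Units.inv_mul,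
          tensorMul_one convList_one convList_one]

/-- A Hopf algebra `H'` that is isomorphic as an algebra to `H` by a map that carries the
comultiplication, the counit and the antipode to those of the twist of `H` by `F`. -/
structure IsTwistBy (F : (H ⊗[k] H)ˣ) {H' : Type*} [Ring H'] [HopfAlgebra k H']
    (e : H' ≃ₐ[k] H) : Prop where
  map_comul : ∀ x, TensorProduct.map e.toLinearMap e.toLinearMap (Coalgebra.comul (R := k) x) =
    (F : H ⊗[k] H) * Coalgebra.comul (R := k) (e x) * ((F⁻¹ : (H ⊗[k] H)ˣ) : H ⊗[k] H)
  counit_map : ∀ x, Coalgebra.counit (R := k) (e x) = Coalgebra.counit (R := k) x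
  map_antipode : ∀ x, e (HopfAlgebra.antipode k x) =
    twistU F * HopfAlgebra.antipode k (e x) * twistUInv F

/-- This is Δ_F⁽ⁿ⁾ = F⁽ⁿ⁾ Δ⁽ⁿ⁾ (F⁽ⁿ⁾)⁻¹. In the induction, the first tensor factor passes through
the cocycle of the remaining slots, and conjugation by F in Δ_F supplies the new factor of F⁽ⁿ⁾. -/
theorem IsTwistBy.convList_comp {H' : Type*} [Ring H'] [HopfAlgebra k H'] {e : H' ≃ₐ[k] H}
    (he : IsTwistBy F e) {L : List (H →ₐ[k] A)} (hL : CommutingImages L) (x : H') :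
    convList (L.map fun g => g.comp e.toAlgHom) x =
      iteratedCocycle F L * convList L (e x) * iteratedCocycleInv F L := by
  induction L generalizing x with
  | nil => simp [iteratedCocycle, iteratedCocycleInv, he.counit_map]
  | cons g L ih =>
    have hL' : CommutingImages L := (List.pairwise_cons.1 hL).2
    have hc : ∀ y, Commute (g y) (iteratedCocycle F L) := fun y =>
      commute_iteratedCocycle fun f hf z => (List.pairwise_cons.1 hL).1 f hf y z
    have key : ∀ X : H' ⊗[k] H', tensorMul (g.comp e.toAlgHom).toLinearMap
          (convList (L.map fun g => g.comp e.toAlgHom)) X =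
        iteratedCocycle F L * tensorMul g.toLinearMap (convList L)
          (TensorProduct.map e.toLinearMap e.toLinearMap X) * iteratedCocycleInv F L := fun X => by
      induction X using TensorProduct.induction_on with
      | zero => simp
      | add X₁ X₂ h₁ h₂ => simp only [map_add, h₁, h₂, mul_add, add_mul]
      | tmul a b =>
        simp only [tensorMul_tmul, TensorProduct.map_tmul, ih hL']
        simp only [← mul_assoc, AlgEquiv.toLinearMap_apply, AlgHom.toLinearMap_apply,
          ← (hc (e a)).eq]
        rfl
    rw [List.map_cons, convList_cons, key, he.map_comul, hL.tensorMul_cons_mul,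
      hL.tensorMul_cons_mul, iteratedCocycle, iteratedCocycleInv, convList_cons]
    simp only [mul_assoc]

end IteratedCocycle

/-! ### The trace form τ, its invariance, and the cancellation of the cocycles. -/

section TraceForm

variable {k : Type*} [Field k] {H : Type*} [Ring H] [HopfAlgebra k H]
  {A : Type*} [Ring A] [Algebra k A]

/-- The linear form `X ↦ Tr(h ↦ S(m(X D(h))))`. -/
def antipodeTrace (m : A →ₗ[k] H) (D : H →ₗ[k] A) : A →ₗ[k] k where
  toFun X := LinearMap.trace k H (HopfAlgebra.antipode k ∘ₗ m ∘ₗ LinearMap.mulLeft k X ∘ₗ D)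
  map_add' X Y := by
    rw [← map_add]
    congr 1
    ext h
    simp [add_mul]
  map_smul' c X := by
    rw [RingHom.id_apply, ← map_smul]
    congr 1
    ext h
    simp

theorem antipodeTrace_apply (m : A →ₗ[k] H) (D : H →ₗ[k] A) (X : A) :
    antipodeTrace m D X =
      LinearMap.trace k H (HopfAlgebra.antipode k ∘ₗ m ∘ₗ LinearMap.mulLeft k X ∘ₗ D) := rfl

theorem trace_mulLeft_mulRight (f : H →ₗ[k] H) (a b : H) :
    LinearMap.trace k H (LinearMap.mulLeft k a ∘ₗ LinearMap.mulRight k b ∘ₗ f) =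
      LinearMap.trace k H (f ∘ₗ LinearMap.mulLeft k a ∘ₗ LinearMap.mulRight k b) := by
  rw [← LinearMap.comp_assoc]
  exact LinearMap.trace_mul_comm k _ f

/-- A linear map `m` that behaves like the product `a₁ ⊗ ⋯ ⊗ aₙ ↦ a₁ ⋯ aₙ` with respect to
algebra maps `g₁, …, gₙ₋₁` into the positions `1, …, n - 1` (the list `L`), algebra maps
`g₁', …, gₙ₋₁'` into the positions `2, …, n` (the list `L'`), and algebra maps `g` and `g'` into
the last and the first position. -/
structure IsProductLike (m : A →ₗ[k] H) (L L' : List (H →ₐ[k] A)) (g g' : H →ₐ[k] A) : Prop where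
  commuting : CommutingImages (L ++ [g])
  commuting' : CommutingImages (g' :: L')
  mul_last : ∀ X c, m (X * g c) = m X * c
  first_mul : ∀ X c, m (g' c * X) = c * m X
  shift : ∀ X h, m (X * convList L h) = m (convList L' h * X)
  shift_inv : ∀ (F : (H ⊗[k] H)ˣ) (X),
    m (X * iteratedCocycleInv F L) = m (iteratedCocycleInv F L' * X)

variable {m : A →ₗ[k] H} {L L' : List (H →ₐ[k] A)} {g g' : H →ₐ[k] A}

/-- For Y = a ⊗ b and Z = c ⊗ d, the outer slots give a on the left and d on the right of m, while
L'(b) shifts to L(b) on the right. Thus S(m(⋯)) = S(d) S(m(X L(c h b))) S(a), and cyclicity of the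
trace moves S(d) and S(a) onto h, producing c S(d) h S(a) b. -/
theorem IsProductLike.antipodeTrace_mul (hm : IsProductLike m L L' g g') (Y Z : H ⊗[k] H) (X : A) :
    antipodeTrace m (convList L)
        (tensorMul g'.toLinearMap (convList L') Y * X * tensorMul (convList L) g.toLinearMap Z) =
      LinearMap.trace k H ((HopfAlgebra.antipode k ∘ₗ m ∘ₗ LinearMap.mulLeft k X ∘ₗ convList L) ∘ₗ
        LinearMap.mulLeft k (antipodeRight 1 Z) ∘ₗ LinearMap.mulRight k (antipodeLeft 1 Y)) := by
  induction Y using TensorProduct.induction_on with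
  | zero => simp
  | add Y₁ Y₂ h₁ h₂ =>
    simp only [map_add, add_mul, h₁, h₂]
    rw [← map_add]
    congr 1
    ext h
    simp [mul_add]
  | tmul a b =>
    induction Z using TensorProduct.induction_on with
    | zero => simp
    | add Z₁ Z₂ h₁ h₂ =>
      simp only [map_add, mul_add, h₁, h₂]
      rw [← map_add]
      congr 1
      ext h
      simp [add_mul, mul_add]
    | tmul c d =>
      have hL : CommutingImages L := (List.pairwise_append.1 hm.commuting).1
      set f := HopfAlgebra.antipode k ∘ₗ m ∘ₗ LinearMap.mulLeft k X ∘ₗ convList L with hf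
      have h1 : HopfAlgebra.antipode k ∘ₗ m ∘ₗ LinearMap.mulLeft k
          (tensorMul g'.toLinearMap (convList L') (a ⊗ₜ[k] b) * X *
            tensorMul (convList L) g.toLinearMap (c ⊗ₜ[k] d)) ∘ₗ convList L =
          LinearMap.mulLeft k (HopfAlgebra.antipode k d) ∘ₗ
            LinearMap.mulRight k (HopfAlgebra.antipode k a) ∘ₗ
              (f ∘ₗ LinearMap.mulLeft k c ∘ₗ LinearMap.mulRight k b) := by
        ext h
        have hgh : Commute (g d) (convList L h) := by
          simpa using (hm.commuting.commute_convList h d).symm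
        have h2 : m (g' a * convList L' b * X * (convList L c * g d) * convList L h) =
            a * m (X * convList L (c * (h * b))) * d := by
          rw [mul_assoc, mul_assoc (convList L c), hgh.eq, mul_assoc (g' a), mul_assoc (g' a),
            hm.first_mul, ← mul_assoc (convList L c), ← mul_assoc (convList L' b * X), hm.mul_last,
            mul_assoc (convList L' b), ← hm.shift, mul_assoc X, ← hL.convList_mul,
            ← hL.convList_mul, mul_assoc c, mul_assoc a]
        simpa [hf, HopfAlgebra.antipode_mul_antidistrib, mul_assoc] using
          congrArg (HopfAlgebra.antipode k) h2
      rw [antipodeTrace_apply, h1, trace_mulLeft_mulRight]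
      congr 1
      ext h
      simp [mul_assoc]

/-- The case Y = 1, Z = Δ(v) of `antipodeTrace_mul`, where v₍₁₎ S(v₍₂₎) = ε(v). -/
theorem IsProductLike.antipodeTrace_mul_convList (hm : IsProductLike m L L' g g') (X : A) (v : H) :
    antipodeTrace m (convList L) (X * convList (L ++ [g]) v) =
      Coalgebra.counit (R := k) v • antipodeTrace m (convList L) X := by
  have h := hm.antipodeTrace_mul 1 (Coalgebra.comul (R := k) v) X
  rw [tensorMul_one (map_one g') convList_one, one_mul, antipodeRight_comul,
    Algebra.TensorProduct.one_def, antipodeLeft_tmul] at h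
  rw [convList_append, convList_singleton, h, antipodeTrace_apply, ← map_smul]
  congr 1
  ext h
  simp [← Algebra.smul_def]

theorem IsProductLike.antipodeTrace_convList_mul (hm : IsProductLike m L L' g g') (X : A) (v : H) :
    antipodeTrace m (convList L) (convList (g' :: L') v * X) =
      Coalgebra.counit (R := k) v • antipodeTrace m (convList L) X := by
  have h := hm.antipodeTrace_mul (Coalgebra.comul (R := k) v) 1 X
  rw [tensorMul_one convList_one (map_one g), mul_one, antipodeLeft_comul,
    Algebra.TensorProduct.one_def, antipodeRight_tmul] at h
  rw [convList_cons, h, antipodeTrace_apply, ← map_smul]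
  congr 1
  ext h
  simp [Algebra.algebraMap_eq_smul_one]

theorem tensorMul_convList_antipode {P : List (H →ₐ[k] A)} (hP : CommutingImages P)
    (X : H ⊗[k] H) : tensorMul (convList P) (convList P ∘ₗ HopfAlgebra.antipode k) X =
      convList P (antipodeRight 1 X) := by
  induction X using TensorProduct.induction_on with
  | zero => simp
  | add X₁ X₂ h₁ h₂ => simp only [map_add, h₁, h₂]
  | tmul a b => simp [hP.convList_mul]

theorem tensorMul_antipode_convList {P : List (H →ₐ[k] A)} (hP : CommutingImages P)
    (X : H ⊗[k] H) : tensorMul (convList P ∘ₗ HopfAlgebra.antipode k) (convList P) X =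
      convList P (antipodeLeft 1 X) := by
  induction X using TensorProduct.induction_on with
  | zero => simp
  | add X₁ X₂ h₁ h₂ => simp only [map_add, h₁, h₂]
  | tmul a b => simp [hP.convList_mul]

theorem convList_algebraMap {P : List (H →ₐ[k] A)} (c : k) :
    convList P (algebraMap k H c) = algebraMap k A c := by
  rw [Algebra.algebraMap_eq_smul_one, map_smul, convList_one, Algebra.algebraMap_eq_smul_one]

/-- Since P is multiplicative, P ∘ S is its convolution inverse, so P can be cancelled from the
convolution product P * Q. -/
theorem convList_eq_antipode_left {P Q : List (H →ₐ[k] A)} (hP : CommutingImages P) (v : H) :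
    convList Q v = tensorMul (convList P ∘ₗ HopfAlgebra.antipode k) (convList (P ++ Q))
      (Coalgebra.comul v) := by
  have h1 : WithConv.toConv (convList P ∘ₗ HopfAlgebra.antipode k) * WithConv.toConv (convList P) =
      1 := by
    ext x
    refine (tensorMul_antipode_convList hP _).trans ?_
    rw [antipodeLeft_comul, convList_algebraMap]
    rfl
  have h2 : WithConv.toConv (convList (P ++ Q)) =
      WithConv.toConv (convList P) * WithConv.toConv (convList Q) := by
    ext x
    exact convList_append P Q x
  have h3 : WithConv.toConv (convList Q) =
      WithConv.toConv (convList P ∘ₗ HopfAlgebra.antipode k) *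
        WithConv.toConv (convList (P ++ Q)) := by
    rw [h2, ← mul_assoc, h1, one_mul]
  exact LinearMap.congr_fun (congrArg WithConv.ofConv h3) v

theorem convList_eq_antipode_right {P Q : List (H →ₐ[k] A)} (hP : CommutingImages P) (v : H) :
    convList Q v = tensorMul (convList (Q ++ P)) (convList P ∘ₗ HopfAlgebra.antipode k)
      (Coalgebra.comul v) := by
  have h1 : WithConv.toConv (convList P) * WithConv.toConv (convList P ∘ₗ HopfAlgebra.antipode k) =
      1 := by
    ext x
    refine (tensorMul_convList_antipode hP _).trans ?_
    rw [antipodeRight_comul, convList_algebraMap]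
    rfl
  have h2 : WithConv.toConv (convList (Q ++ P)) =
      WithConv.toConv (convList Q) * WithConv.toConv (convList P) := by
    ext x
    exact convList_append Q P x
  have h3 : WithConv.toConv (convList Q) = WithConv.toConv (convList (Q ++ P)) *
      WithConv.toConv (convList P ∘ₗ HopfAlgebra.antipode k) := by
    rw [h2, mul_assoc, h1, mul_one]
  exact LinearMap.congr_fun (congrArg WithConv.ofConv h3) v

/-- Invariance replaces D(v₍₂₎) by ε(v₍₂₎), and the counit axiom collapses the sum. -/
theorem apply_mul_tensorMul_comul {τ : A →ₗ[k] k} {f D : H →ₗ[k] A}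
    (h : ∀ X v, τ (X * D v) = Coalgebra.counit (R := k) v • τ X) (X : A) (v : H) :
    τ (X * tensorMul f D (Coalgebra.comul (R := k) v)) = τ (X * f v) := by
  have key : ∀ Y : H ⊗[k] H, τ (X * tensorMul f D Y) = τ (X * f (counitRight k H Y)) := fun Y => by
    induction Y using TensorProduct.induction_on with
    | zero => simp
    | add Y₁ Y₂ h₁ h₂ => simp only [map_add, mul_add, h₁, h₂]
    | tmul a b => simp [counitRight, ← mul_assoc, h]
  rw [key, counitRight_comul]

theorem apply_tensorMul_comul_mul {τ : A →ₗ[k] k} {f D : H →ₗ[k] A}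
    (h : ∀ X v, τ (D v * X) = Coalgebra.counit (R := k) v • τ X) (X : A) (v : H) :
    τ (tensorMul D f (Coalgebra.comul (R := k) v) * X) = τ (f v * X) := by
  have key : ∀ Y : H ⊗[k] H, τ (tensorMul D f Y * X) = τ (f (counitLeft k H Y) * X) := fun Y => by
    induction Y using TensorProduct.induction_on with
    | zero => simp
    | add Y₁ Y₂ h₁ h₂ => simp only [map_add, add_mul, h₁, h₂]
    | tmul a b => simp [counitLeft, mul_assoc, h]
  rw [key, counitLeft_comul]

/-- A linear form that is invariant under right multiplication by `Δ⁽ⁿ⁾` and under left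
multiplication by a cyclic rotation of `Δ⁽ⁿ⁾` takes the same value at `1` and at the product of
the rotated inverse of the iterated cocycle with the iterated cocycle. -/
theorem IsTwoCocycle.apply_cocycle_rotate {F : (H ⊗[k] H)ˣ} (hF : IsTwoCocycle F)
    {P Q : List (H →ₐ[k] A)} (hPQ : CommutingImages (P ++ Q)) (hQP : CommutingImages (Q ++ P))
    {τ : A →ₗ[k] k} (hr : ∀ X v, τ (X * convList (P ++ Q) v) = Coalgebra.counit (R := k) v • τ X)
    (hl : ∀ X v, τ (convList (Q ++ P) v * X) = Coalgebra.counit (R := k) v • τ X) :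
    τ (iteratedCocycleInv F (Q ++ P) * iteratedCocycle F (P ++ Q)) = τ 1 := by
  have hP : CommutingImages P := (List.pairwise_append.1 hPQ).1
  have hQ : CommutingImages Q := (List.pairwise_append.1 hQP).1
  -- Write Q(v) as P(S(v₍₁₎)) (PQ)(v₍₂₎) and let τ absorb the invariant factor; `hl'` is the mirror
  -- image.
  have hr' : ∀ X v, τ (X * convList Q v) = τ (X * convList P (HopfAlgebra.antipode k v)) :=
    fun X v => by
      rw [convList_eq_antipode_left hP v, apply_mul_tensorMul_comul hr]
      rfl
  have hl' : ∀ X v, τ (convList Q v * X) = τ (convList P (HopfAlgebra.antipode k v) * X) :=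
    fun X v => by
      rw [convList_eq_antipode_right hP v, apply_tensorMul_comul_mul hl]
      rfl
  -- For Y = a ⊗ b and Z = c ⊗ d, both outer factors Q(a) and Q(d) become values of P ∘ S, leaving
  -- P(S(a) b c S(d)). For Y = F⁻¹ and Z = F this is P(u⁻¹u).
  have key : ∀ Y Z : H ⊗[k] H, τ (tensorMul (convList Q) (convList P) Y *
      tensorMul (convList P) (convList Q) Z) =
        τ (convList P (antipodeLeft 1 Y * antipodeRight 1 Z)) := fun Y Z => by
    induction Y using TensorProduct.induction_on with
    | zero => simp
    | add Y₁ Y₂ h₁ h₂ => simp only [map_add, add_mul, h₁, h₂]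
    | tmul a b =>
      induction Z using TensorProduct.induction_on with
      | zero => simp
      | add Z₁ Z₂ h₁ h₂ => simp only [map_add, mul_add, h₁, h₂]
      | tmul c d =>
        simp only [tensorMul_tmul, antipodeLeft_tmul, antipodeRight_tmul, mul_one]
        rw [mul_assoc, hl', ← mul_assoc, ← mul_assoc, hr']
        simp only [hP.convList_mul, mul_assoc]
  have e1 : iteratedCocycleInv F P * iteratedCocycle F P = 1 := hP.cocycle_inv_mul
  have e2 : iteratedCocycleInv F Q * iteratedCocycle F Q = 1 := hQ.cocycle_inv_mul
  -- After both cocycles are split, the parts living on P alone and on Q alone cancel, because they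
  -- commute with each other.
  have e3 : iteratedCocycleInv F (Q ++ P) * iteratedCocycle F (P ++ Q) =
      tensorMul (convList Q) (convList P) ((F⁻¹ : (H ⊗[k] H)ˣ) : H ⊗[k] H) *
        tensorMul (convList P) (convList Q) (F : H ⊗[k] H) := by
    rw [hF.iteratedCocycleInv_append hQP, hF.iteratedCocycle_append hPQ]
    calc _ = tensorMul (convList Q) (convList P) ((F⁻¹ : (H ⊗[k] H)ˣ) : H ⊗[k] H) *
          (iteratedCocycleInv F P * ((iteratedCocycleInv F Q * iteratedCocycle F P) *
            iteratedCocycle F Q)) * tensorMul (convList P) (convList Q) (F : H ⊗[k] H) := by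
          simp only [mul_assoc]
      _ = _ := by
          have hc : Commute (iteratedCocycle F P) (iteratedCocycle F Q) :=
            commute_iteratedCocycle fun g hg x => (commute_iteratedCocycle fun f hf y =>
              (((List.pairwise_append.1 hPQ).2.2 f hf g hg y x).symm)).symm
          rw [mul_assoc (iteratedCocycleInv F Q), hc.eq, ← mul_assoc (iteratedCocycleInv F Q), e2,
            one_mul, e1, mul_one]
  rw [e3, key]
  exact congrArg τ ((congrArg (convList P) hF.uInv_mul_u).trans convList_one)

theorem IsProductLike.trace_twist {F : (H ⊗[k] H)ˣ} (hm : IsProductLike m L L' g g')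
    (hF : IsTwoCocycle F) (hrot : (g' :: L') ~r (L ++ [g])) :
    LinearMap.trace k H (LinearMap.mulLeft k (twistU F) ∘ₗ LinearMap.mulRight k (twistUInv F) ∘ₗ
        HopfAlgebra.antipode k ∘ₗ m ∘ₗ LinearMap.mulRight k (iteratedCocycleInv F L) ∘ₗ
          LinearMap.mulLeft k (iteratedCocycle F L) ∘ₗ convList L) =
      LinearMap.trace k H (HopfAlgebra.antipode k ∘ₗ m ∘ₗ convList L) := by
  -- The inverse cocycle moves from right to left under m, and its slots L become the shifted slots
  -- L'.
  have h1 : m ∘ₗ LinearMap.mulRight k (iteratedCocycleInv F L) ∘ₗ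
      LinearMap.mulLeft k (iteratedCocycle F L) ∘ₗ convList L =
      m ∘ₗ LinearMap.mulLeft k (iteratedCocycleInv F L' * iteratedCocycle F L) ∘ₗ convList L := by
    ext h
    simpa [mul_assoc] using hm.shift_inv F (iteratedCocycle F L * convList L h)
  have h2 := hm.antipodeTrace_mul ((F⁻¹ : (H ⊗[k] H)ˣ) : H ⊗[k] H) (F : H ⊗[k] H)
    (iteratedCocycleInv F L' * iteratedCocycle F L)
  -- The factors F⁻¹ and F coming from u⁻¹ and u are exactly what extends the two iterated cocycles
  -- by the missing slot.
  have h3 : tensorMul g'.toLinearMap (convList L') ((F⁻¹ : (H ⊗[k] H)ˣ) : H ⊗[k] H) *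
      (iteratedCocycleInv F L' * iteratedCocycle F L) *
        tensorMul (convList L) g.toLinearMap (F : H ⊗[k] H) =
      iteratedCocycleInv F (g' :: L') * iteratedCocycle F (L ++ [g]) := by
    have hg : iteratedCocycle F [g] = 1 := by
      have : ∀ X : H ⊗[k] H, tensorMul g.toLinearMap (convList []) X = g (counitRight k H X) :=
        fun X => by
          induction X using TensorProduct.induction_on with
          | zero => simp
          | add X₁ X₂ h₁ h₂ => simp only [map_add, h₁, h₂]
          | tmul a b =>
            simp [counitRight, Algebra.algebraMap_eq_smul_one]
      simp [iteratedCocycle, this, hF.counit_right]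
    rw [hF.iteratedCocycle_append hm.commuting, hg, convList_singleton, iteratedCocycleInv]
    simp only [mul_assoc, one_mul]
  rw [h3] at h2
  rw [h1, trace_mulLeft_mulRight]
  refine h2.symm.trans ?_
  obtain ⟨i, hi, hi'⟩ := List.isRotated_iff_mod.1 hrot
  rw [List.rotate_eq_drop_append_take hi] at hi'
  have hQP : (g' :: L').take i ++ (g' :: L').drop i = g' :: L' := List.take_append_drop _ _
  -- Rotation by i exchanges the initial segment Q of length i with the rest P: g' :: L' is QP and L
  -- ++ [g] is PQ.
  have h4 := hF.apply_cocycle_rotate (P := (g' :: L').drop i) (Q := (g' :: L').take i)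
    (τ := antipodeTrace m (convList L)) (by rw [hi']; exact hm.commuting)
    (by rw [hQP]; exact hm.commuting')
    (by rw [hi']; exact hm.antipodeTrace_mul_convList)
    (by rw [hQP]; exact hm.antipodeTrace_convList_mul)
  rw [hi', hQP] at h4
  rw [h4, antipodeTrace_apply]
  congr 1
  ext h
  simp

end TraceForm

/-! ### Slots in tensor powers and the iterated product. -/

section TensorPower

variable (k : Type*) [Field k] {H : Type*} [Ring H] [HopfAlgebra k H]

/-- The algebra map `a ↦ 1 ⊗ ⋯ ⊗ a ⊗ ⋯ ⊗ 1` into the position `i` of `H^{⊗ n}`. -/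
def position {n : ℕ} (i : Fin n) : H →ₐ[k] ⨂[k]^n H :=
  PiTensorProduct.singleAlgHom (R := k) (A := fun _ : Fin n => H) i

theorem position_apply {n : ℕ} (i : Fin n) (a : H) :
    position k i a = PiTensorProduct.tprod k (Pi.mulSingle i a : Fin n → H) := rfl

theorem commute_position {n : ℕ} {i j : Fin n} (hij : i ≠ j) (a b : H) :
    Commute (position k i a) (position k j b) := by
  rw [position_apply, position_apply]
  exact Commute.tprod (Pi.mulSingle_commute (f := fun _ : Fin n => H) hij a b)

theorem commutingImages_position {n : ℕ} {s : List (Fin n)} (hs : s.Nodup) :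
    CommutingImages (s.map (position k (H := H))) :=
  List.Pairwise.map _ (fun _ _ h => commute_position k h) hs

variable (H)

/-- The algebra map `H^{⊗ n} → H^{⊗ (n+1)}`, `t ↦ 1 ⊗ t`. -/
def oneCons (n : ℕ) : (⨂[k]^n H) →ₐ[k] ⨂[k]^(n + 1) H :=
  PiTensorProduct.liftAlgHom
    ((PiTensorProduct.tprod k (s := fun _ : Fin (n + 1) => H)).curryLeft 1)
    (by
      refine congrArg (PiTensorProduct.tprod k) ?_
      ext i
      refine Fin.cases ?_ (fun i => ?_) i <;> simp)
    (fun x y => by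
      simp only [MultilinearMap.curryLeft_apply, PiTensorProduct.tprod_mul_tprod]
      congr 1
      ext i
      refine Fin.cases ?_ (fun i => ?_) i <;> simp)

theorem oneCons_tprod {n : ℕ} (v : Fin n → H) :
    oneCons k H n (PiTensorProduct.tprod k v) =
      PiTensorProduct.tprod k (Fin.cons 1 v : Fin (n + 1) → H) :=
  PiTensorProduct.lift.tprod (R := k) v

/-- The algebra map `H^{⊗ n} → H^{⊗ (n+1)}`, `t ↦ t ⊗ 1`. -/
def snocOne (n : ℕ) : (⨂[k]^n H) →ₐ[k] ⨂[k]^(n + 1) H :=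
  PiTensorProduct.liftAlgHom
    ((LinearMap.applyₗ (1 : H)).compMultilinearMap
      (PiTensorProduct.tprod k (s := fun _ : Fin (n + 1) => H)).curryRight)
    (by
      simp only [LinearMap.compMultilinearMap_apply, LinearMap.applyₗ_apply_apply,
        MultilinearMap.curryRight_apply]
      refine congrArg (PiTensorProduct.tprod k) ?_
      ext i
      refine Fin.lastCases ?_ (fun i => ?_) i <;> simp)
    (fun x y => by
      simp only [LinearMap.compMultilinearMap_apply, LinearMap.applyₗ_apply_apply,
        MultilinearMap.curryRight_apply, PiTensorProduct.tprod_mul_tprod]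
      congr 1
      ext i
      refine Fin.lastCases ?_ (fun i => ?_) i <;> simp)

theorem snocOne_tprod {n : ℕ} (v : Fin n → H) :
    snocOne k H n (PiTensorProduct.tprod k v) =
      PiTensorProduct.tprod k (Fin.snoc v 1 : Fin (n + 1) → H) := by
  simp [snocOne]

/-- The permutation of tensors as an algebra map. -/
def permAlgHom {n : ℕ} (σ : Equiv.Perm (Fin n)) : (⨂[k]^n H) →ₐ[k] ⨂[k]^n H :=
  AlgHom.ofLinearMap (permTensor k H σ) (permTensor_tprod k H σ 1) (fun x y => by
    induction x using PiTensorProduct.induction_on with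
    | add x₁ x₂ h₁ h₂ => simp only [add_mul, map_add, h₁, h₂]
    | smul_tprod r v =>
      induction y using PiTensorProduct.induction_on with
      | add y₁ y₂ h₁ h₂ => simp only [mul_add, map_add, h₁, h₂]
      | smul_tprod s w =>
        simp only [smul_mul_assoc, mul_smul_comm, map_smul, PiTensorProduct.tprod_mul_tprod,
          permTensor_tprod]
        rfl)

variable {H}

theorem permAlgHom_apply {n : ℕ} (σ : Equiv.Perm (Fin n)) (x : ⨂[k]^n H) :
    permAlgHom k H σ x = permTensor k H σ x := rfl

theorem oneCons_comp_position {n : ℕ} (i : Fin n) :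
    (oneCons k H n).comp (position k i) = position k i.succ := by
  ext a
  rw [AlgHom.comp_apply, position_apply, position_apply, oneCons_tprod]
  congr 1
  ext j
  refine Fin.cases ?_ (fun j => ?_) j
  · simp [(Fin.succ_ne_zero i).symm]
  · simp [Pi.mulSingle_apply]

theorem snocOne_comp_position {n : ℕ} (i : Fin n) :
    (snocOne k H n).comp (position k i) = position k i.castSucc := by
  ext a
  rw [AlgHom.comp_apply, position_apply, position_apply, snocOne_tprod]
  congr 1
  ext j
  refine Fin.lastCases ?_ (fun j => ?_) j
  · simp [(Fin.castSucc_lt_last i).ne']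
  · simp [Pi.mulSingle_apply]

theorem permAlgHom_comp_position {n : ℕ} (σ : Equiv.Perm (Fin n)) (i : Fin n) :
    (permAlgHom k H σ).comp (position k i) = position k (σ.symm i) := by
  ext a
  rw [AlgHom.comp_apply, position_apply, position_apply, permAlgHom_apply, permTensor_tprod]
  congr 1
  ext j
  simp [Pi.mulSingle_apply, Equiv.eq_symm_apply]

theorem tensorCons_tmul {n : ℕ} (a : H) (t : ⨂[k]^n H) :
    tensorCons k H n (a ⊗ₜ[k] t) = position k 0 a * oneCons k H n t := by
  induction t using PiTensorProduct.induction_on with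
  | add x y hx hy => simp only [TensorProduct.tmul_add, map_add, mul_add, hx, hy]
  | smul_tprod r v =>
    rw [TensorProduct.tmul_smul, map_smul, map_smul, mul_smul_comm, tensorCons_tmul_tprod,
      oneCons_tprod, position_apply, PiTensorProduct.tprod_mul_tprod]
    congr 2
    ext j
    refine Fin.cases ?_ (fun j => ?_) j <;> simp

/-- Links the recursive Δ⁽ⁿ⁾ with the list formalism: prepending a tensor factor is multiplying slot
0 by 1 ⊗ t, and t ↦ 1 ⊗ t raises each slot by one. -/
theorem iteratedComul_eq_convList (n : ℕ) (x : H) :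
    iteratedComul k H n x = convList ((List.finRange n).map (position k)) x := by
  induction n generalizing x with
  | zero =>
    rw [List.finRange_zero, List.map_nil, convList_nil, Algebra.algebraMap_eq_smul_one]
    rfl
  | succ n ih =>
    have key : ∀ X : H ⊗[k] H, tensorCons k H n ((iteratedComul k H n).lTensor H X) =
        tensorMul (position k 0).toLinearMap
          (convList ((List.finRange n).map fun i => position k i.succ)) X := fun X => by
      induction X using TensorProduct.induction_on with
      | zero => simp
      | add X₁ X₂ h₁ h₂ => simp only [map_add, h₁, h₂]
      | tmul a b =>
        rw [LinearMap.lTensor_tmul, tensorCons_tmul, ih, map_convList, tensorMul_tmul,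
          List.map_map]
        simp only [Function.comp_def, oneCons_comp_position]
        rfl
    rw [List.finRange_succ, List.map_cons, convList_cons, List.map_map]
    exact key _

theorem iteratedMul_mul_position_last {n : ℕ} (X : ⨂[k]^(n + 1) H) (c : H) :
    iteratedMul k H (n + 1) (X * position k (Fin.last n) c) = iteratedMul k H (n + 1) X * c := by
  induction X using PiTensorProduct.induction_on with
  | add x y hx hy => simp only [map_add, add_mul, hx, hy]
  | smul_tprod r v =>
    rw [position_apply, smul_mul_assoc, map_smul, map_smul, smul_mul_assoc,
      PiTensorProduct.tprod_mul_tprod, iteratedMul_tprod, iteratedMul_tprod, List.ofFn_succ',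
      List.ofFn_succ']
    simp [(Fin.castSucc_lt_last _).ne, mul_assoc]

theorem iteratedMul_position_zero_mul {n : ℕ} (X : ⨂[k]^(n + 1) H) (c : H) :
    iteratedMul k H (n + 1) (position k 0 c * X) = c * iteratedMul k H (n + 1) X := by
  induction X using PiTensorProduct.induction_on with
  | add x y hx hy => simp only [map_add, mul_add, hx, hy]
  | smul_tprod r v =>
    rw [position_apply, mul_smul_comm, map_smul, map_smul, mul_smul_comm,
      PiTensorProduct.tprod_mul_tprod, iteratedMul_tprod, iteratedMul_tprod, List.ofFn_succ,
      List.ofFn_succ]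
    simp [mul_assoc]

/-- Both sides are the interleaved word v₀ w₀ v₁ w₁ ⋯ wₙ₋₁ vₙ; they differ only in whether each wᵢ
is grouped with vᵢ or with vᵢ₊₁. -/
theorem prod_ofFn_mul_snoc {n : ℕ} (v : Fin (n + 1) → H) (w : Fin n → H) :
    (List.ofFn (v * (Fin.snoc w 1 : Fin (n + 1) → H))).prod =
      (List.ofFn ((Fin.cons 1 w : Fin (n + 1) → H) * v)).prod := by
  induction n with
  | zero => simp [Fin.snoc]
  | succ n ih =>
    have h := ih (fun i => v i.succ) (fun i => w i.succ)
    have h1 : (fun i : Fin (n + 1) => (v * (Fin.snoc w 1 : Fin (n + 2) → H)) i.succ) =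
        (fun i => v i.succ) * (Fin.snoc (fun i => w i.succ) 1 : Fin (n + 1) → H) := by
      ext i
      refine Fin.lastCases ?_ (fun i => ?_) i
      · simp [Fin.succ_last]
      · simp only [Pi.mul_apply, Fin.snoc_castSucc, Fin.succ_castSucc]
    rw [List.ofFn_succ, List.prod_cons, h1, h, List.ofFn_succ, List.prod_cons]
    have h3 : (Fin.snoc w 1 : Fin (n + 2) → H) 0 = w 0 := Fin.snoc_castSucc (α := fun _ => H) 1 w 0
    simp [h3, mul_assoc]

/-- The shift identity that motivates the extra slot. -/
theorem iteratedMul_mul_snocOne {n : ℕ} (X : ⨂[k]^(n + 1) H) (t : ⨂[k]^n H) :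
    iteratedMul k H (n + 1) (X * snocOne k H n t) =
      iteratedMul k H (n + 1) (oneCons k H n t * X) := by
  induction X using PiTensorProduct.induction_on with
  | add x y hx hy => simp only [map_add, add_mul, mul_add, hx, hy]
  | smul_tprod r v =>
    induction t using PiTensorProduct.induction_on with
    | add x y hx hy => simp only [map_add, add_mul, mul_add, hx, hy]
    | smul_tprod s w =>
      simp only [map_smul, smul_mul_assoc, mul_smul_comm, snocOne_tprod, oneCons_tprod,
        PiTensorProduct.tprod_mul_tprod, iteratedMul_tprod, prod_ofFn_mul_snoc]
      rw [smul_comm]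

theorem iteratedMul_snocOne {n : ℕ} (t : ⨂[k]^n H) :
    iteratedMul k H (n + 1) (snocOne k H n t) = iteratedMul k H n t := by
  induction t using PiTensorProduct.induction_on with
  | add x y hx hy => simp only [map_add, hx, hy]
  | smul_tprod s w =>
    rw [map_smul, map_smul, map_smul, snocOne_tprod, iteratedMul_tprod, iteratedMul_tprod,
      List.ofFn_succ']
    simp

end TensorPower

/-! ### Trace invariance for slot permutations compatible with rotation. -/

section TwistInvariance

variable {k : Type*} [Field k] {H : Type*} [Ring H] [HopfAlgebra k H]
  {H' : Type*} [Ring H'] [HopfAlgebra k H']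

/-- The algebra map `H'^{⊗ n} → H^{⊗ n}` induced by an algebra map `H' → H`. -/
def mapTensorPower (e : H' →ₐ[k] H) (n : ℕ) : (⨂[k]^n H') →ₐ[k] ⨂[k]^n H :=
  PiTensorProduct.liftAlgHom
    ((PiTensorProduct.tprod k (s := fun _ : Fin n => H)).compLinearMap fun _ => e.toLinearMap)
    (congrArg (PiTensorProduct.tprod k) (funext fun _ => map_one e))
    (fun x y => by
      simp only [MultilinearMap.compLinearMap_apply, PiTensorProduct.tprod_mul_tprod]
      exact congrArg (PiTensorProduct.tprod k) (funext fun _ => map_mul e _ _))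

theorem mapTensorPower_tprod (e : H' →ₐ[k] H) {n : ℕ} (v : Fin n → H') :
    mapTensorPower e n (PiTensorProduct.tprod k v) =
      PiTensorProduct.tprod k (fun i => e (v i)) :=
  PiTensorProduct.lift.tprod (R := k) v

theorem mapTensorPower_comp_position (e : H' →ₐ[k] H) {n : ℕ} (i : Fin n) :
    (mapTensorPower e n).comp (position k i) = (position k i).comp e := by
  ext a
  rw [AlgHom.comp_apply, AlgHom.comp_apply, position_apply, position_apply, mapTensorPower_tprod]
  congr 1
  ext j
  by_cases h : j = i
  · subst h; simp
  · simp [h]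

theorem iteratedMul_permTensor_mapTensorPower (e : H' →ₐ[k] H) {n : ℕ} (σ : Equiv.Perm (Fin n))
    (t : ⨂[k]^n H') : iteratedMul k H n (permTensor k H σ (mapTensorPower e n t)) =
      e (iteratedMul k H' n (permTensor k H' σ t)) := by
  induction t using PiTensorProduct.induction_on with
  | add x y hx hy => simp only [map_add, hx, hy]
  | smul_tprod s w =>
    simp only [map_smul, mapTensorPower_tprod, permTensor_tprod, iteratedMul_tprod,
      map_list_prod, List.map_ofFn]
    rfl

variable {F : (H ⊗[k] H)ˣ}

/-- The slots of the factors of `Δ⁽ⁿ⁾(x)` permuted by `σ`, in `H^{⊗ n} ⊗ 1`, followed by the last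
slot, are a rotation of the first slot followed by the slots in `1 ⊗ H^{⊗ n}`. -/
def RotatesSlots {n : ℕ} (σ : Equiv.Perm (Fin n)) : Prop :=
  ((0 : Fin (n + 1)) :: (List.finRange n).map fun i => (σ.symm i).succ) ~r
    ((List.finRange n).map (fun i => (σ.symm i).castSucc) ++ [Fin.last n])

theorem RotatesSlots.isProductLike {n : ℕ} {σ : Equiv.Perm (Fin n)} (hσ : RotatesSlots σ) :
    IsProductLike (iteratedMul k H (n + 1))
      ((List.finRange n).map fun i => position k (σ.symm i).castSucc)
      ((List.finRange n).map fun i => position k (σ.symm i).succ)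
      (position k (Fin.last n)) (position k 0) := by
  have hs : ((0 : Fin (n + 1)) :: (List.finRange n).map fun i => (σ.symm i).succ).Nodup := by
    refine List.nodup_cons.2 ⟨by simp [Fin.succ_ne_zero], ?_⟩
    exact (List.nodup_finRange n).map ((Fin.succ_injective n).comp σ.symm.injective)
  -- Both slot lists are images of the standard list under algebra maps. Hence their convolution
  -- products and inverse cocycles have the forms t ⊗ 1 and 1 ⊗ t with the same t, and the shift
  -- identity applies to both. The inverse of σ appears because entry i lands in slot σ⁻¹(i).
  have hL : ∀ φ : (⨂[k]^n H) →ₐ[k] ⨂[k]^(n + 1) H,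
      (List.finRange n).map (fun i => φ.comp (position k (σ.symm i))) =
        ((List.finRange n).map (position k)).map (φ.comp (permAlgHom k H σ)).comp := fun φ => by
    rw [List.map_map]
    congr 1
    ext1 i
    rw [Function.comp_apply, AlgHom.comp_assoc, permAlgHom_comp_position]
  have hL1 := hL (snocOne k H n)
  have hL2 := hL (oneCons k H n)
  simp only [snocOne_comp_position] at hL1
  simp only [oneCons_comp_position] at hL2
  refine ⟨?_, ?_, iteratedMul_mul_position_last k, iteratedMul_position_zero_mul k, ?_, ?_⟩
  · simpa [Function.comp_def] using commutingImages_position k (H := H) (hσ.nodup_iff.1 hs)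
  · simpa [Function.comp_def] using commutingImages_position k (H := H) hs
  · intro X h
    rw [hL1, hL2, ← map_convList, ← map_convList]
    exact iteratedMul_mul_snocOne k X _
  · intro F X
    rw [hL1, hL2, ← map_iteratedCocycleInv, ← map_iteratedCocycleInv]
    exact iteratedMul_mul_snocOne k X _

theorem IsTwistBy.mapTensorPower_iteratedComul {e : H' ≃ₐ[k] H} (he : IsTwistBy F e) (n : ℕ)
    (x : H') : mapTensorPower e.toAlgHom n (iteratedComul k H' n x) =
      iteratedCocycle F ((List.finRange n).map (position k)) * iteratedComul k H n (e x) *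
        iteratedCocycleInv F ((List.finRange n).map (position k)) := by
  rw [iteratedComul_eq_convList, iteratedComul_eq_convList, map_convList,
    ← he.convList_comp (commutingImages_position k (List.nodup_finRange n)), List.map_map,
    List.map_map]
  simp only [Function.comp_def, mapTensorPower_comp_position]

theorem IsTwistBy.trace_antipode_perm {e : H' ≃ₐ[k] H} (he : IsTwistBy F e)
    (hF : IsTwoCocycle F) {n : ℕ} {σ : Equiv.Perm (Fin n)} (hσ : RotatesSlots σ) :
    LinearMap.trace k H' (HopfAlgebra.antipode k ∘ₗ iteratedMul k H' n ∘ₗ permTensor k H' σ ∘ₗ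
        iteratedComul k H' n) =
      LinearMap.trace k H (HopfAlgebra.antipode k ∘ₗ iteratedMul k H n ∘ₗ permTensor k H σ ∘ₗ
        iteratedComul k H n) := by
  set L : List (H →ₐ[k] ⨂[k]^(n + 1) H) :=
    (List.finRange n).map fun i => position k (σ.symm i).castSucc with hL
  have hL' : L = ((List.finRange n).map (position k)).map
      ((snocOne k H n).comp (permAlgHom k H σ)).comp := by
    rw [hL, List.map_map]
    congr 1
    ext1 i
    rw [Function.comp_apply, AlgHom.comp_assoc, permAlgHom_comp_position, snocOne_comp_position]
  have h1 : ∀ t : ⨂[k]^n H, iteratedMul k H n (permTensor k H σ t) =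
      iteratedMul k H (n + 1) ((snocOne k H n).comp (permAlgHom k H σ) t) := fun t =>
    (iteratedMul_snocOne k _).symm
  have h2 := hσ.isProductLike.trace_twist (k := k) (H := H) hF (by
    simpa [Function.comp_def] using List.IsRotated.map hσ (position k (H := H)))
  rw [← hL] at h2
  -- Transport along e puts both traces on H, where the twisted structure is explicit.
  rw [← LinearMap.trace_conj' _ e.toLinearEquiv]
  refine Eq.trans ?_ (h2.trans ?_)
  · congr 1
    ext x
    have h3 := he.mapTensorPower_iteratedComul n (e.symm x)
    rw [AlgEquiv.apply_symm_apply] at h3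
    simp only [LinearEquiv.conj_apply, LinearMap.comp_apply, LinearEquiv.coe_coe,
      AlgEquiv.toLinearEquiv_apply, LinearMap.mulLeft_apply, LinearMap.mulRight_apply]
    refine (he.map_antipode _).trans ?_
    have h4 := iteratedMul_permTensor_mapTensorPower e.toAlgHom σ
      (iteratedComul k H' n (e.symm x))
    rw [h3, h1, map_mul ((snocOne k H n).comp (permAlgHom k H σ)),
      map_mul ((snocOne k H n).comp (permAlgHom k H σ)), map_iteratedCocycle, map_iteratedCocycleInv,
      iteratedComul_eq_convList, map_convList, ← hL'] at h4
    rw [mul_assoc, h4]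
    rfl
  · congr 1
    ext x
    simp only [LinearMap.comp_apply]
    rw [h1, iteratedComul_eq_convList, map_convList, ← hL']

/-- Both f ∘ S and S ∘ f are convolution inverses of f: one on the left, the other on the right. -/
theorem map_antipode_of_bialgHom (f : H →ₐc[k] H') (x : H) :
    f (HopfAlgebra.antipode k x) = HopfAlgebra.antipode k (f x) := by
  have h1 : WithConv.toConv ((f : H →ₗ[k] H') ∘ₗ HopfAlgebra.antipode k) *
      WithConv.toConv (f : H →ₗ[k] H') = 1 := by
    ext y
    have key : ∀ X : H ⊗[k] H, tensorMul ((f : H →ₗ[k] H') ∘ₗ HopfAlgebra.antipode k)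
        (f : H →ₗ[k] H') X = f (antipodeLeft 1 X) := fun X => by
      induction X using TensorProduct.induction_on with
      | zero => simp
      | add X₁ X₂ h₁ h₂ => simp only [map_add, h₁, h₂]
      | tmul a b => simp
    refine (key _).trans ?_
    rw [antipodeLeft_comul, Algebra.algebraMap_eq_smul_one, map_smul, map_one,
      ← Algebra.algebraMap_eq_smul_one]
    rfl
  have h2 : WithConv.toConv (f : H →ₗ[k] H') *
      WithConv.toConv (HopfAlgebra.antipode k ∘ₗ (f : H →ₗ[k] H')) = 1 := by
    ext y
    have key : ∀ X : H ⊗[k] H, tensorMul (f : H →ₗ[k] H')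
        (HopfAlgebra.antipode k ∘ₗ (f : H →ₗ[k] H')) X =
          antipodeRight 1 (TensorProduct.map (f : H →ₗ[k] H') (f : H →ₗ[k] H') X) := fun X => by
      induction X using TensorProduct.induction_on with
      | zero => simp
      | add X₁ X₂ h₁ h₂ => simp only [map_add, h₁, h₂]
      | tmul a b => simp
    have hf : TensorProduct.map (f : H →ₗ[k] H') (f : H →ₗ[k] H') (Coalgebra.comul (R := k) y) =
        Coalgebra.comul (R := k) (f y) := CoalgHomClass.map_comp_comul_apply f y
    refine (key _).trans ?_
    rw [hf, antipodeRight_comul, CoalgHomClass.counit_comp_apply]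
    rfl
  exact LinearMap.congr_fun (congrArg WithConv.ofConv (left_inv_eq_right_inv h1 h2)) x

theorem IsTwistBy.trans {H'' : Type*} [Ring H''] [HopfAlgebra k H''] {e : H' ≃ₐ[k] H}
    (he : IsTwistBy F e) (f : H'' ≃ₐc[k] H') : IsTwistBy F ((f : H'' ≃ₐ[k] H').trans e) where
  map_comul x := by
    have h : TensorProduct.map (f : H'' →ₗ[k] H') (f : H'' →ₗ[k] H') (Coalgebra.comul (R := k) x) =
        Coalgebra.comul (R := k) (f x) := CoalgHomClass.map_comp_comul_apply f x
    refine Eq.trans ?_ (he.map_comul (f x))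
    rw [← h]
    exact LinearMap.congr_fun (TensorProduct.map_comp (R := k) (e : H' →ₗ[k] H) (e : H' →ₗ[k] H)
      (f : H'' →ₗ[k] H') (f : H'' →ₗ[k] H')) _
  counit_map x := (he.counit_map (f x)).trans (CoalgHomClass.counit_comp_apply f x)
  map_antipode x := by
    refine Eq.trans ?_ (he.map_antipode (f x))
    exact congrArg e (map_antipode_of_bialgHom (f : H'' →ₐc[k] H') x)

/-- The identity of `H`, as an algebra isomorphism from `H_F` to `H`. -/
def drinfeldTwistEquiv (hF : IsTwoCocycle F) : DrinfeldTwist F hF ≃ₐ[k] H :=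
  (AlgEquiv.refl : H ≃ₐ[k] H)

theorem isTwistBy_drinfeldTwist (hF : IsTwoCocycle F) : IsTwistBy F (drinfeldTwistEquiv hF) where
  map_comul x := by
    refine Eq.trans ?_ (DrinfeldTwist.comul_eq hF x)
    exact LinearMap.congr_fun (TensorProduct.map_id (R := k) (M := H) (N := H)) _
  counit_map x := (DrinfeldTwist.counit_eq hF x).symm
  map_antipode x := DrinfeldTwist.antipode_eq hF x

end TwistInvariance

/-! ### Multiplication by l modulo n rotates the slots. -/

section ShuffleRotation

theorem shufflePerm_one (n : ℕ) : shufflePerm n 1 isCoprime_one_right = 1 := by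
  ext i
  have hi := i.2
  simp only [shufflePerm, shuffleFun, Equiv.ofBijective_apply, Equiv.Perm.coe_one, id_eq, mul_one]
  rw [Int.emod_eq_of_lt (by omega) (by omega)]
  omega

/-- Modulo n + 1, with entries counted from 0, the first list is s[j] = j/l and the second is t[j] =
(j + 1)/l - 1 = (j + 1 - l)/l. So t is s rotated by 1 - l. -/
theorem rotatesSlots_shufflePerm (n : ℕ) (l : ℤ) (hl : IsCoprime ((n + 1 : ℕ) : ℤ) l) :
    RotatesSlots (n := n) (shufflePerm (n + 1) l hl) := by
  set σ : Equiv.Perm (Fin n) := shufflePerm (n + 1) l hl with hσ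
  have hpos : (0 : ℤ) < ((n + 1 : ℕ) : ℤ) := by omega
  have h0 : ∀ i : Fin n, (((σ.symm i : ℕ) + 1 : ℤ) * l) ≡ (i : ℕ) + 1 [ZMOD ((n + 1 : ℕ) : ℤ)] :=
    fun i => by
      have h := shuffle_bounds hl (σ.symm i)
      have h' : (σ (σ.symm i) : ℕ) = ((((σ.symm i : ℕ) + 1 : ℤ) * l) % (n + 1 : ℕ)).toNat - 1 := rfl
      rw [Equiv.apply_symm_apply] at h'
      have h2 : (((σ.symm i : ℕ) + 1 : ℤ) * l) % (n + 1 : ℕ) = (i : ℕ) + 1 := by omega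
      have hi := i.2
      rw [Int.ModEq, h2, Int.emod_eq_of_lt (by omega) (by omega)]
  set s := ((0 : Fin (n + 1)) :: (List.finRange n).map fun i => (σ.symm i).succ) with hs
  set t := ((List.finRange n).map (fun i => (σ.symm i).castSucc) ++ [Fin.last n]) with ht
  have hsl : s.length = n + 1 := by simp [hs]
  have htl : t.length = n + 1 := by simp [ht]
  -- The prepended slot 0 extends the congruence of `h0` to j = 0; in `h2` the appended last slot
  -- does so for the residue of n + 1.
  have h1 : ∀ j (hj : j < s.length), ((s[j] : ℕ) : ℤ) * l ≡ j [ZMOD ((n + 1 : ℕ) : ℤ)] := by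
    intro j hj
    cases j with
    | zero => simp [hs, Int.ModEq]
    | succ j =>
      have := h0 ⟨j, by omega⟩
      simpa [hs] using this
  have h2 : ∀ j (hj : j < t.length),
      (((t[j] : ℕ) : ℤ) + 1) * l ≡ j + 1 [ZMOD ((n + 1 : ℕ) : ℤ)] := by
    intro j hj
    by_cases hjn : j < n
    · have := h0 ⟨j, hjn⟩
      simpa [ht, List.getElem_append, hjn] using this
    · obtain rfl : j = n := by omega
      simp [ht, Int.ModEq]
  refine ⟨((1 - l) % (n + 1 : ℕ)).toNat, ?_⟩
  set r := ((1 - l) % (n + 1 : ℕ)).toNat with hr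
  have hr' : (r : ℤ) ≡ 1 - l [ZMOD ((n + 1 : ℕ) : ℤ)] := by
    rw [hr, Int.toNat_of_nonneg (Int.emod_nonneg _ hpos.ne')]
    exact Int.mod_modEq _ _
  refine List.ext_getElem (by rw [List.length_rotate, hsl, htl]) fun j hj hj' => ?_
  rw [List.getElem_rotate]
  have h3 := h1 ((j + r) % s.length) (Nat.mod_lt _ (by omega))
  have h4 := h2 j hj'
  generalize s[(j + r) % s.length]'_ = a at h3 ⊢
  generalize t[j] = b at h4 ⊢
  have h5 : (((j + r) % s.length : ℕ) : ℤ) ≡ j + (1 - l) [ZMOD ((n + 1 : ℕ) : ℤ)] := by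
    rw [hsl]
    push_cast
    exact (Int.mod_modEq _ _).trans (Int.ModEq.add_left _ hr')
  -- Coprimality then removes l, and two slots congruent modulo n + 1 coincide.
  have h6 : (((n + 1 : ℕ) : ℤ)) ∣ ((b : ℕ) - (a : ℕ) : ℤ) * l := by
    have h7 := (h3.trans h5).dvd
    have h8 := h4.dvd
    have : ((b : ℕ) - (a : ℕ) : ℤ) * l =
      ((j : ℤ) + (1 - l) - (a : ℕ) * l) - ((j : ℤ) + 1 - ((b : ℕ) + 1) * l) := by ring
    rw [this]
    exact dvd_sub h7 h8
  have h7 := Int.eq_zero_of_abs_lt_dvd (hl.dvd_of_dvd_mul_right h6)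
    (by rw [abs_lt]; have := a.2; have := b.2; omega)
  exact Fin.ext (by omega)

end ShuffleRotation

/-- Stated for an arbitrary realization e of the twist, so that H_F and every bialgebra isomorphic
to it are covered at once. -/
theorem IsTwistBy.shuffledIndicator_eq {k : Type*} [Field k] {H : Type*} [Ring H]
    [HopfAlgebra k H] {H' : Type*} [Ring H'] [HopfAlgebra k H'] {F : (H ⊗[k] H)ˣ}
    {e : H' ≃ₐ[k] H} (he : IsTwistBy F e) (hF : IsTwoCocycle F) {n : ℕ} (hn : n ≠ 0) (l : ℤ)
    (hl : IsCoprime (n : ℤ) l) : shuffledIndicator k H' n l hl = shuffledIndicator k H n l hl := by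
  obtain ⟨n, rfl⟩ := Nat.exists_eq_succ_of_ne_zero hn
  exact he.trace_antipode_perm hF (rotatesSlots_shufflePerm n l hl)

theorem shuffledIndicator_one (k : Type*) [Field k] (H : Type*) [Ring H] [HopfAlgebra k H]
    (n : ℕ) : shuffledIndicator k H n 1 isCoprime_one_right = kmnIndicator k H n := by
  have h : permTensor k H (1 : Equiv.Perm (Fin (n - 1))) = LinearMap.id := by
    ext v
    exact permTensor_tprod k H 1 v
  rw [shuffledIndicator, shuffledSweedlerPower, shufflePerm_one, h, LinearMap.id_comp]
  rfl

end

theorem mainTheorem4 {k : Type*} [Field k] {H : Type*} [Ring H] [HopfAlgebra k H]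
    [FiniteDimensional k H] (F : (H ⊗[k] H)ˣ) (hF : IsTwoCocycle F)
    (n : ℕ) (hn : 1 < n) (l : ℤ) (hl : IsCoprime (n : ℤ) l) :
    shuffledIndicator k (DrinfeldTwist F hF) n l hl = shuffledIndicator k H n l hl ∧
    (∀ (H' : Type*) [Ring H'] [HopfAlgebra k H'], Nonempty (H' ≃ₐc[k] DrinfeldTwist F hF) →
      shuffledIndicator k H' n l hl = shuffledIndicator k H n l hl) ∧
    shuffledIndicator k H n 1 isCoprime_one_right = kmnIndicator k H n :=
  ⟨(isTwistBy_drinfeldTwist hF).shuffledIndicator_eq hF (by omega) l hl,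
    fun _ _ _ ⟨f⟩ => ((isTwistBy_drinfeldTwist hF).trans f).shuffledIndicator_eq hF (by omega) l hl,
    shuffledIndicator_one k H n⟩
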